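/- Let $G$ be a compact (Hausdorff) group and let $\rho_1,\dots,\rho_k$ be continuous unitary representations of $G$ on nonzero finite-dimensional Hilbert spaces $\mathcal H_1,\dots,\mathcal H_k$. For $n\in\mathbb N^k$ put $\rho^n=\rho_1^{\otimes n_1}\otimes\cdots\otimes\rho_k^{\otimes n_k}$ (with $\rho^0$ the trivial representation), let $\hat G$ be the set of equivalence classes of irreducible unitary representations of $G$, and let $R\subseteq\hat G$ be the set of classes that occur as direct summands of some $\rho^n$. Assume that every $\rho_i$ is faithful and that $R=\hat G$. Consider the $k$-coloured directed graph with vertex set $\Lambda^0=R$ whose set $\Lambda^{\varepsilon_i}$ of edges of colour $i$ contains, for all $v,w\in R$, exactly $$M_i(w,v)=\dim \mathrm{Hom}(v,\,w\otimes\rho_i)$$ edges with source $v$ and range $w$ ($\varepsilon_i$ denotes the $i$-th generator of $\mathbb N^k$). Write $\Lambda^{\varepsilon_i}\times_{\Lambda^0}\Lambda^{\varepsilon_j}=\{(e,f)\in\Lambda^{\varepsilon_i}\times\Lambda^{\varepsilon_j}: s(e)=r(f)\}$. For all $1\le i<j\le k$ let $$\lambda_{ij}:\Lambda^{\varepsilon_i}\times_{\Lambda^0}\Lambda^{\varepsilon_j}\to\Lambda^{\varepsilon_j}\times_{\Lambda^0}\Lambda^{\varepsilon_i},\qquad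 \lambda_{ij}(e,f)=(f',e'),$$ be bijections with $r(f')=r(e)$ and $s(e')=s(f)$, and assume that for all $i<j<\ell$ $$(\mathrm{id}_\ell\times\lambda_{ij})(\lambda_{i\ell}\times\mathrm{id}_j)(\mathrm{id}_i\times\lambda_{j\ell})=(\lambda_{j\ell}\times\mathrm{id}_i)(\mathrm{id}_j\times\lambda_{i\ell})(\lambda_{ij}\times\mathrm{id}_\ell)$$ as maps $\Lambda^{\varepsilon_i}\times_{\Lambda^0}\Lambda^{\varepsilon_j}\times_{\Lambda^0}\Lambda^{\varepsilon_\ell}\to\Lambda^{\varepsilon_\ell}\times_{\Lambda^0}\Lambda^{\varepsilon_j}\times_{\Lambda^0}\Lambda^{\varepsilon_i}$. A rank $k$ graph is a countable small category $\Lambda$ with range and source maps $r,s$ and a functor $d:\Lambda\to\mathbb N^k$ such that every $\lambda\in\Lambda$ with $d(\lambda)=m+n$ has a unique factorization $\lambda=\mu\nu$ with $d(\mu)=m$ and $d(\nu)=n$; put $\Lambda^n=d^{-1}(n)$. Then there is a rank $k$ graph $\Lambda$ with this vertex set, with these sets of edges as $\Lambda^{\varepsilon_1},\dots,\Lambda^{\varepsilon_k}$,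 and such that $ef=f'e'$ in $\Lambda$ whenever $i<j$ and $\lambda_{ij}(e,f)=(f',e')$. It is unique up to an isomorphism of rank $k$ graphs that fixes the vertices and the edges. Moreover $\Lambda$ has the following properties. 1. It is cofinal: for every infinite path $x$ (a degree-preserving functor to $\Lambda$ from the $k$-graph $\Omega_k=\{(m,n)\in\mathbb N^k\times\mathbb N^k: m\le n\}$ with $r(m,n)=m$, $s(m,n)=n$, $d(m,n)=n-m$) and every vertex $v$ there are $\lambda\in\Lambda$ and $n\in\mathbb N^k$ with $s(\lambda)=x(n)$ and $r(\lambda)=v$. 2. It is locally finite: for every vertex $v$ and every $n\in\mathbb N^k$ only finitely many $\lambda\in\Lambda^n$ have range $v$, and only finitely many have source $v$. 3. It has no sources: for every vertex $v$ and every $n\in\mathbb N^k$ there is $\lambda\in\Lambda^n$ with $r(\lambda)=v$. -/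

import Mathlib

open CategoryTheory
open scoped TensorProduct

universe u v

attribute [-instance] catToReflQuiver

namespace RepKGraph

/-! ## Unitary representations and the dual of a group -/

/-- A (strongly continuous) unitary representation of `G` on `H`: a homomorphism from `G` to the
group of surjective linear isometries of `H`. -/
structure UnitaryRep (G : Type u) [Group G] [TopologicalSpace G]
    (H : Type v) [NormedAddCommGroup H] [InnerProductSpace ℂ H] where
  toHom : G →* (H ≃ₗᵢ[ℂ] H)
  continuous_apply : ∀ x : H, Continuous fun g => toHom g x

/-- The underlying linear representation. -/
def UnitaryRep.toRepresentation {G : Type u} [Group G] [TopologicalSpace G]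
    {H : Type v} [NormedAddCommGroup H] [InnerProductSpace ℂ H] (ρ : UnitaryRep G H) :
    Representation ℂ G H where
  toFun g := (ρ.toHom g).toLinearEquiv.toLinearMap
  map_one' := by ext x; simp
  map_mul' g h := by ext x; simp

/-- Irreducible finite-dimensional unitary representations. Every finite-dimensional Hilbert space
is isometric to a space `EuclideanSpace ℂ (Fin dim)`, so only these are used. -/
structure Irrep (G : Type u) [Group G] [TopologicalSpace G] where
  dim : ℕ
  rep : UnitaryRep G (EuclideanSpace ℂ (Fin dim))
  irreducible : rep.toRepresentation.IsIrreducible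

/-- Equivalence of irreducible representations: existence of an invertible intertwiner (for
irreducible unitary representations this is the same as unitary equivalence). -/
instance Irrep.setoid (G : Type u) [Group G] [TopologicalSpace G] : Setoid (Irrep G) where
  r π σ := Nonempty (Representation.Equiv π.rep.toRepresentation σ.rep.toRepresentation)
  iseqv :=
    { refl := fun _ => ⟨Representation.Equiv.refl _⟩
      symm := fun ⟨e⟩ => ⟨e.symm⟩
      trans := fun ⟨e⟩ ⟨f⟩ => ⟨e.trans f⟩ }

/-- The dual `Ĝ` of a compact group: the equivalence classes of its irreducible unitary
representations. -/
def UnitaryDual (G : Type u) [Group G] [TopologicalSpace G] : Type u :=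
  Quotient (Irrep.setoid G)

/-- A chosen representative of a class in `Ĝ`, as a linear representation. -/
noncomputable def UnitaryDual.rep {G : Type u} [Group G] [TopologicalSpace G] (w : UnitaryDual G) :
    Representation ℂ G (EuclideanSpace ℂ (Fin (Quotient.out w).dim)) :=
  (Quotient.out w).rep.toRepresentation

/-- The multiplicity `M(w, v) = dim Hom(v, w ⊗ σ)` of `v` in `w ⊗ σ`. -/
noncomputable def tensorMult {G : Type u} [Group G] [TopologicalSpace G]
    {H : Type v} [NormedAddCommGroup H] [InnerProductSpace ℂ H] (σ : UnitaryRep G H)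
    (w v : UnitaryDual G) : ℕ :=
  Module.finrank ℂ
    (Representation.IntertwiningMap v.rep (Representation.tprod w.rep σ.toRepresentation))

section Powers

variable {G : Type u} [Group G] [TopologicalSpace G] {k : ℕ} {H : Fin k → Type v}
  [∀ i, NormedAddCommGroup (H i)] [∀ i, InnerProductSpace ℂ (H i)]

/-- The tensor power `ρⁿ = ρ₁^{⊗ n₁} ⊗ ⋯ ⊗ ρₖ^{⊗ nₖ}`: one tensor factor `H i` for every pair
`(i, t)` with `t < n i`, and `g` acts by `⨂ ρ i (g)`. -/
noncomputable def tensorPower (ρ : ∀ i, UnitaryRep G (H i)) (n : Fin k → ℕ) :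
    Representation ℂ G (⨂[ℂ] p : (Σ i, Fin (n i)), H p.1) where
  toFun g := PiTensorProduct.map fun p => (ρ p.1).toRepresentation g
  map_one' := by
    simp only [map_one]
    exact PiTensorProduct.map_one
  map_mul' g h := by
    simp only [map_mul]
    exact PiTensorProduct.map_mul _ _

/-- The set `R` of all classes of irreducible representations which are direct summands of some
tensor power `ρⁿ`, `n ∈ ℕᵏ`. -/
def constituents (ρ : ∀ i, UnitaryRep G (H i)) : Set (UnitaryDual G) :=
  {w | ∃ (n : Fin k → ℕ) (a : Representation.IntertwiningMap w.rep (tensorPower ρ n))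
    (b : Representation.IntertwiningMap (tensorPower ρ n) w.rep), ∀ x, b (a x) = x}

end Powers

/-! ## Rank `k` graphs -/

/-- A rank `k` graph: a countable small category with a degree functor to `ℕᵏ` which has the
factorization property. A path `p` with source `a` and range `b` is a morphism `p : a ⟶ b`, so
that the product `μν` of paths (`s(μ) = r(ν)`) is `ν ≫ μ`. -/
structure KGraph (k : ℕ) where
  Vertex : Type u
  [category : SmallCategory.{u} Vertex]
  countable : Countable (Σ a b : Vertex, (a ⟶ b))
  deg : ∀ {a b : Vertex}, (a ⟶ b) → (Fin k → ℕ)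
  deg_id : ∀ a : Vertex, deg (𝟙 a) = 0
  deg_comp : ∀ {a b c : Vertex} (ν : a ⟶ b) (μ : b ⟶ c), deg (ν ≫ μ) = deg μ + deg ν
  factorization : ∀ {a b : Vertex} (p : a ⟶ b) (m n : Fin k → ℕ), deg p = m + n →
    ∃! q : (Σ c : Vertex, (c ⟶ b) × (a ⟶ c)),
      q.2.2 ≫ q.2.1 = p ∧ deg q.2.1 = m ∧ deg q.2.2 = n

attribute [instance] KGraph.category

namespace KGraph

variable {k : ℕ} (Λ : KGraph.{u} k)

/-- `Λ` is locally finite: for every vertex `v` and every degree `n`, only finitely many paths of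
degree `n` have range `v` and only finitely many paths of degree `n` have source `v`. -/
def LocallyFinite : Prop :=
  ∀ (v : Λ.Vertex) (n : Fin k → ℕ),
    Finite (Σ a, {p : a ⟶ v // Λ.deg p = n}) ∧ Finite (Σ b, {p : v ⟶ b // Λ.deg p = n})

/-- `Λ` has no sources: `vΛⁿ` is non-empty for every vertex `v` and every degree `n`. -/
def NoSources : Prop :=
  ∀ (v : Λ.Vertex) (n : Fin k → ℕ), Nonempty (Σ a, {p : a ⟶ v // Λ.deg p = n})

/-- Infinite paths: degree preserving functors to `Λ` from the `k`-graph `Ω` with vertices `ℕᵏ`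
and one path of degree `n - m`, with range `m` and source `n`, for each pair `m ≤ n`. -/
structure InfinitePath where
  obj : (Fin k → ℕ) → Λ.Vertex
  map : ∀ {m n : Fin k → ℕ}, m ≤ n → (obj n ⟶ obj m)
  map_refl : ∀ m : Fin k → ℕ, map (le_refl m) = 𝟙 (obj m)
  map_trans : ∀ {l m n : Fin k → ℕ} (hlm : l ≤ m) (hmn : m ≤ n),
    map (hlm.trans hmn) = map hmn ≫ map hlm
  deg_map : ∀ {m n : Fin k → ℕ} (h : m ≤ n), Λ.deg (map h) = n - m

/-- `Λ` is cofinal: for every infinite path `x` and every vertex `v` there are `n` and a path with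
source `x(n)` and range `v`. -/
def Cofinal : Prop :=
  ∀ (x : Λ.InfinitePath) (v : Λ.Vertex), ∃ n : Fin k → ℕ,
    Nonempty (x.obj n ⟶ v)

/-- Isomorphisms of `k`-graphs: degree preserving functors that are bijective on vertices and on
paths. -/
structure Iso (Λ Λ' : KGraph.{u} k) where
  toFunctor : Λ.Vertex ⥤ Λ'.Vertex
  bijective_obj : Function.Bijective toFunctor.obj
  bijective_map : ∀ a b : Λ.Vertex, Function.Bijective fun p : a ⟶ b => toFunctor.map p
  deg_map : ∀ {a b : Λ.Vertex} (p : a ⟶ b), Λ'.deg (toFunctor.map p) = Λ.deg p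

end KGraph

/-! ## Coloured graphs and commuting squares -/

/-- A `k`-coloured directed graph with vertex set `V`; `Edge i w v` is the set of edges of colour
`i` with range `w` and source `v`. -/
structure ColouredGraph (k : ℕ) (V : Type u) where
  Edge : Fin k → V → V → Type u

namespace ColouredGraph

variable {k : ℕ} {V : Type u} (E : ColouredGraph k V)

/-- The elements `(e, f)` of `Λ^{εᵢ} ×_{Λ⁰} Λ^{εⱼ}` with `r(e) = w` and `s(f) = v`, the first
component being the common vertex `s(e) = r(f)`. -/
abbrev Pairs (i j : Fin k) (w v : V) : Type u := Σ x : V, E.Edge i w x × E.Edge j x v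

/-- The composable triples `(e, f, g)` of edges of colours `i, j, l` with `r(e) = w` and
`s(g) = v`. -/
abbrev Triples (i j l : Fin k) (w v : V) : Type u :=
  Σ x y : V, E.Edge i w x × E.Edge j x y × E.Edge l y v

/-- The maps `φ × id`. -/
def onLeft {i j i' j' : Fin k} (φ : ∀ w v, E.Pairs i j w v → E.Pairs i' j' w v) (l : Fin k)
    (w v : V) (t : E.Triples i j l w v) : E.Triples i' j' l w v :=
  let q := φ w t.2.1 ⟨t.1, t.2.2.1, t.2.2.2.1⟩
  ⟨q.1, t.2.1, q.2.1, q.2.2, t.2.2.2.2⟩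

/-- The maps `id × φ`. -/
def onRight {j l j' l' : Fin k} (φ : ∀ w v, E.Pairs j l w v → E.Pairs j' l' w v) (i : Fin k)
    (w v : V) (t : E.Triples i j l w v) : E.Triples i j' l' w v :=
  let q := φ t.1 v ⟨t.2.1, t.2.2.2.1, t.2.2.2.2⟩
  ⟨t.1, q.1, t.2.2.1, q.2.1, q.2.2⟩

/-- A collection of commuting squares: for all `i < j` a bijection
`λᵢⱼ : Λ^{εᵢ} ×_{Λ⁰} Λ^{εⱼ} → Λ^{εⱼ} ×_{Λ⁰} Λ^{εᵢ}` which preserves the range and the source of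
the two-edge paths, that is, a family of bijections indexed by the range `w` and the source `v`. -/
abbrev Squares : Type u :=
  ∀ i j : Fin k, i < j → ∀ w v : V, E.Pairs i j w v ≃ E.Pairs j i w v

/-- The associativity condition
`(id_l × λᵢⱼ)(λᵢₗ × id_j)(id_i × λⱼₗ) = (λⱼₗ × id_i)(id_j × λᵢₗ)(λᵢⱼ × id_l)` for `i < j < l`. -/
def IsAssociative (sq : E.Squares) : Prop :=
  ∀ (i j l : Fin k) (hij : i < j) (hjl : j < l) (w v : V) (t : E.Triples i j l w v),
    E.onRight (fun w v => sq i j hij w v) l w v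
        (E.onLeft (fun w v => sq i l (hij.trans hjl) w v) j w v
          (E.onRight (fun w v => sq j l hjl w v) i w v t)) =
      E.onLeft (fun w v => sq j l hjl w v) i w v
        (E.onRight (fun w v => sq i l (hij.trans hjl) w v) j w v
          (E.onLeft (fun w v => sq i j hij w v) l w v t))

/-- The data which exhibit `Λ` as a `k`-graph with skeleton `E` and commuting squares `sq`:
identifications of `V` with the vertices of `Λ` and of the edges of colour `i` with the paths of
degree `εᵢ` (preserving range and source), such that `ef = f'e'` in `Λ` whenever
`λᵢⱼ(e, f) = (f', e')`. -/
structure Realization (sq : E.Squares) (Λ : KGraph.{u} k) where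
  vertex : V ≃ Λ.Vertex
  edge : ∀ (i : Fin k) (w v : V),
    E.Edge i w v ≃ {p : vertex v ⟶ vertex w // Λ.deg p = Pi.single i 1}
  square : ∀ (i j : Fin k) (hij : i < j) (w v : V) (q : E.Pairs i j w v),
    (edge j q.1 v q.2.2).1 ≫ (edge i w q.1 q.2.1).1 =
      (edge i (sq i j hij w v q).1 v (sq i j hij w v q).2.2).1 ≫
        (edge j w (sq i j hij w v q).1 (sq i j hij w v q).2.1).1

/-- The isomorphism `Φ` carries the vertices and edges of the first realization to those of the
second one. -/
def Realization.Compatible {E : ColouredGraph k V} {sq : E.Squares} {Λ Λ' : KGraph.{u} k}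
    (P : E.Realization sq Λ) (P' : E.Realization sq Λ') (Φ : KGraph.Iso Λ Λ') : Prop :=
  (∀ v : V, Φ.toFunctor.obj (P.vertex v) = P'.vertex v) ∧
    ∀ (i : Fin k) (w v : V) (e : E.Edge i w v),
      (⟨_, _, Φ.toFunctor.map (P.edge i w v e).1⟩ : Σ a b : Λ'.Vertex, (a ⟶ b)) =
        ⟨_, _, (P'.edge i w v e).1⟩

end ColouredGraph

end RepKGraph

-- In a `k`-graph every path factors uniquely along each word of colours that represents its degree.
-- A path is therefore the same thing as an edge path whose colours come in one fixed order, here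
-- descending. This dictates the construction: morphisms are sorted edge paths, and a product
-- inserts the edges of the left factor one by one into the right factor, swapping neighbours by the
-- squares. The crux is `insert_insert`: two adjacent edges may be swapped by a square before being
-- inserted. The associativity condition is what this needs when both edges must pass a third one.
-- Associativity of the product follows (`mul_mul`). As the squares are bijections, the colours of a
-- path can also be rearranged into any given order in exactly one way (`exists_colours_eq`,
-- `eq_of_mul_nil_eq`), which is unique factorization. In any realization, evaluation is bijective
-- on sorted paths (`Realization.bijective_eval`), so every realization is isomorphic to the
-- constructed one.
--
-- The other properties concern multiplicities. A finite-dimensional representation has finitely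
-- many irreducible constituents (`finite_constituents`). Applied to `w ⊗ ρ i`, and after taking
-- adjoints and currying to `Hom(ρ i, v)`, this bounds the edges with given range or given source.
-- There are no sources because `w ⊗ ρ i` is nonzero and so contains an irreducible.
--
-- Cofinality holds because any two vertices are joined by a path. Let `S` be the set of sources of
-- paths with range `w`. Some irreducible `x` inside the conjugate of `w` has a nonzero invariant
-- pairing `w ⊗ x → ℂ`. If `x` occurs in `ρᵐ` and `y` in `ρⁿ`, then `w ⊗ ρᵐ ⊗ ρⁿ` maps nontrivially
-- to `y`. That product is a sum of irreducibles from `S`, so Schur's lemma gives `y ∈ S`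
-- (`ClosedUnderTensor.mem`).

universe w

namespace RepKGraph

/-! ### Sorted edge paths and their product -/

namespace ColouredGraph

variable {k : ℕ} {V : Type u} (E : ColouredGraph k V)

/-- Paths in a coloured graph, written from the range to the source. -/
inductive EdgePath : V → V → Type u
  | nil (v : V) : EdgePath v v
  | cons {w x v : V} (i : Fin k) (e : E.Edge i w x) (p : EdgePath x v) : EdgePath w v

namespace EdgePath

variable {E}

/-- The word of colours of a path. -/
def colours {w v : V} : E.EdgePath w v → List (Fin k)
  | nil _ => []
  | cons i _ p => i :: p.colours

/-- Concatenation of paths. -/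
def append {w x v : V} : E.EdgePath w x → E.EdgePath x v → E.EdgePath w v
  | nil _, q => q
  | cons i e p, q => cons i e (p.append q)

@[simp] theorem colours_append {w x v : V} (p : E.EdgePath w x) (q : E.EdgePath x v) :
    (p.append q).colours = p.colours ++ q.colours := by
  induction p with
  | nil => rfl
  | cons i e p ih => simp [append, colours, ih]

theorem eq_of_append_eq {w x x' v : V} (p : E.EdgePath w x) (p' : E.EdgePath w x')
    (q : E.EdgePath x v)
    (q' : E.EdgePath x' v) (hc : p.colours = p'.colours) (h : p.append q = p'.append q') :
    (⟨x, p, q⟩ : Σ x, E.EdgePath w x × E.EdgePath x v) = ⟨x', p', q'⟩ := by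
  induction p with
  | nil =>
    cases p' with
    | nil => cases h; rfl
    | cons => simp [colours] at hc
  | cons i e p ih =>
    cases p' with
    | nil => simp [colours] at hc
    | cons i' e' p' =>
      simp only [colours, List.cons.injEq] at hc
      obtain ⟨rfl, hc⟩ := hc
      simp only [append] at h
      simp only [cons.injEq, true_and] at h
      obtain ⟨rfl, he, hp⟩ := h
      cases he
      cases ih p' q hc (eq_of_heq hp)
      rfl

theorem exists_append {w v : V} (p : E.EdgePath w v) (c d : List (Fin k)) (h : p.colours = c ++ d) :
    ∃ (x : V) (q : E.EdgePath w x) (r : E.EdgePath x v), q.colours = c ∧ r.colours = d ∧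
      q.append r = p := by
  induction c generalizing w with
  | nil => exact ⟨w, nil w, p, rfl, h, rfl⟩
  | cons i c ih =>
    cases p with
    | nil => simp [colours] at h
    | cons j e p =>
      simp only [colours, List.cons_append, List.cons.injEq] at h
      obtain ⟨rfl, h⟩ := h
      obtain ⟨x, q, r, hq, hr, rfl⟩ := ih p h
      exact ⟨x, cons j e q, r, by simp [colours, hq], hr, rfl⟩

/-- Insertion of an edge into a path: the edge is moved past all the edges of larger colour which
it meets, by means of the commuting squares. -/
def insert (sq : E.Squares) {w x v : V} (i : Fin k) (e : E.Edge i w x) :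
    E.EdgePath x v → E.EdgePath w v
  | nil _ => cons i e (nil _)
  | cons j f p =>
    if h : i < j then
      cons j (sq i j h _ _ ⟨_, e, f⟩).2.1 (insert sq i (sq i j h _ _ ⟨_, e, f⟩).2.2 p)
    else cons i e (cons j f p)

variable (sq : E.Squares)

theorem insert_cons_of_lt {w x y v : V} {i j : Fin k} (h : i < j) (e : E.Edge i w x)
    (f : E.Edge j x y) (p : E.EdgePath y v) :
    insert sq i e (cons j f p) =
      cons j (sq i j h _ _ ⟨_, e, f⟩).2.1 (insert sq i (sq i j h _ _ ⟨_, e, f⟩).2.2 p) := by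
  simp [insert, h]

theorem insert_cons_of_not_lt {w x y v : V} {i j : Fin k} (h : ¬ i < j) (e : E.Edge i w x)
    (f : E.Edge j x y) (p : E.EdgePath y v) :
    insert sq i e (cons j f p) = cons i e (cons j f p) := by
  simp [insert, h]

theorem colours_insert_perm {w x v : V} (i : Fin k) (e : E.Edge i w x) (p : E.EdgePath x v) :
    (insert sq i e p).colours.Perm (i :: p.colours) := by
  induction p generalizing w with
  | nil => exact .refl _
  | cons j f p ih =>
    by_cases h : i < j
    · rw [insert_cons_of_lt sq h]
      exact ((ih _).cons j).trans (.swap _ _ _)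
    · rw [insert_cons_of_not_lt sq h]
      exact .refl _

/-- A path is sorted if its colours are in descending order. -/
def Sorted {w v : V} (p : E.EdgePath w v) : Prop := p.colours.Pairwise (· ≥ ·)

theorem Sorted.insert {w x v : V} (i : Fin k) (e : E.Edge i w x) {p : E.EdgePath x v}
    (hp : p.Sorted) : (insert sq i e p).Sorted := by
  induction p generalizing w with
  | nil => simp [Sorted, EdgePath.insert, colours]
  | cons j f p ih =>
    have hp' := hp
    rw [Sorted, colours, List.pairwise_cons] at hp
    by_cases h : i < j
    · rw [insert_cons_of_lt sq h, Sorted, colours, List.pairwise_cons]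
      refine ⟨fun a ha => ?_, ih _ hp.2⟩
      rcases List.mem_cons.1 ((colours_insert_perm sq _ _ _).subset ha) with rfl | ha
      · exact h.le
      · exact hp.1 a ha
    · rw [insert_cons_of_not_lt sq h, Sorted, colours, List.pairwise_cons]
      refine ⟨fun a ha => ?_, hp'⟩
      rcases List.mem_cons.1 ha with rfl | ha
      · exact not_lt.1 h
      · exact (hp.1 a ha).trans (not_lt.1 h)

/-- The common colour word makes both insertions take the same branches, and each branch is
reversible: either an edge is prepended, or a bijective square is applied. -/
theorem insert_injective {w x x' v : V} (i : Fin k) (e : E.Edge i w x) (e' : E.Edge i w x')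
    (p : E.EdgePath x v) (p' : E.EdgePath x' v) (hc : p.colours = p'.colours)
    (h : insert sq i e p = insert sq i e' p') :
    (⟨x, e, p⟩ : Σ x, E.Edge i w x × E.EdgePath x v) = ⟨x', e', p'⟩ := by
  induction p generalizing w x' with
  | nil =>
    cases p' with
    | nil => cases h; rfl
    | cons => simp [colours] at hc
  | cons j f p ih =>
    cases p' with
    | nil => simp [colours] at hc
    | cons j' f' p' =>
      simp only [colours, List.cons.injEq] at hc
      obtain ⟨rfl, hc⟩ := hc
      by_cases hij : i < j
      · rw [insert_cons_of_lt sq hij, insert_cons_of_lt sq hij] at h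
        have key : ∀ Q Q' : E.Pairs j i w _,
            cons j Q.2.1 (insert sq i Q.2.2 p) = cons j Q'.2.1 (insert sq i Q'.2.2 p') →
            (⟨_, Q, p⟩ : Σ y, E.Pairs j i w y × E.EdgePath y _) = ⟨_, Q', p'⟩ := by
          rintro ⟨y, f₁, e₁⟩ ⟨y', f₁', e₁'⟩ h
          simp only [cons.injEq, true_and] at h
          obtain ⟨rfl, hf, hi⟩ := h
          cases hf
          cases ih e₁ e₁' p' hc (eq_of_heq hi)
          rfl
        have := congrArg (fun t : Σ y, E.Pairs j i w y × E.EdgePath y _ =>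
          (⟨t.1, (sq i j hij w t.1).symm t.2.1, t.2.2⟩ : Σ y, E.Pairs i j w y × E.EdgePath y _))
          (key _ _ h)
        simp only [Equiv.symm_apply_apply] at this
        cases this
        rfl
      · rw [insert_cons_of_not_lt sq hij, insert_cons_of_not_lt sq hij] at h
        cases h
        rfl

/-- This is where the associativity condition enters. Let `l` be the first colour of `p`. If `l >
j`, both edges pass it, and the two orders of passing are the two sides of the condition. If `i < l
≤ j`, only the edge of colour `i` passes; if `l ≤ i`, neither does. -/
theorem insert_insert (hsq : E.IsAssociative sq) {w x v : V} {i j : Fin k} (hij : i < j)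
    (t : E.Pairs i j w x) (p : E.EdgePath x v) :
    insert sq i t.2.1 (insert sq j t.2.2 p) =
      insert sq j (sq i j hij w x t).2.1 (insert sq i (sq i j hij w x t).2.2 p) := by
  induction p generalizing w with
  | nil =>
    simp only [insert, hij, dite_true, not_lt_of_gt hij, dite_false]
  | @cons x y v l g p ih =>
    by_cases hil : i < l
    · by_cases hjl : j < l
      · have key := hsq i j l hij hjl w y ⟨t.1, x, t.2.1, t.2.2, g⟩
        rw [insert_cons_of_lt sq hjl, insert_cons_of_lt sq hil, insert_cons_of_lt sq hil,
          insert_cons_of_lt sq hjl]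
        have := congrArg (fun s : E.Triples l j i w y =>
          cons l s.2.2.1 (insert sq j s.2.2.2.1 (insert sq i s.2.2.2.2 p))) key
        refine Eq.trans ?_ this
        simp only [onLeft, onRight]
        exact congrArg (cons l _) (ih ⟨_, _, _⟩)
      · rw [insert_cons_of_not_lt sq hjl, insert_cons_of_lt sq hij, insert_cons_of_lt sq hil,
          insert_cons_of_not_lt sq hjl]
    · have hjl : ¬ j < l := fun h => hil (hij.trans h)
      rw [insert_cons_of_not_lt sq hjl, insert_cons_of_lt sq hij, insert_cons_of_not_lt sq hil,
          insert_cons_of_not_lt sq (not_lt_of_gt hij)]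

/-- The product of two paths in the `k`-graph: the edges of the first path are inserted one after
the other into the second path. -/
def mul {w x v : V} : E.EdgePath w x → E.EdgePath x v → E.EdgePath w v
  | nil _, q => q
  | cons i e p, q => insert sq i e (mul p q)

@[simp] theorem nil_mul {w v : V} (q : E.EdgePath w v) : mul sq (nil w) q = q := rfl

@[simp] theorem cons_mul {w y x v : V} (i : Fin k) (e : E.Edge i w y) (p : E.EdgePath y x)
    (q : E.EdgePath x v) : mul sq (cons i e p) q = insert sq i e (mul sq p q) := rfl

theorem colours_mul_perm {w x v : V} (p : E.EdgePath w x) (q : E.EdgePath x v) :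
    (mul sq p q).colours.Perm (p.colours ++ q.colours) := by
  induction p with
  | nil => exact .refl _
  | cons i e p ih => exact (colours_insert_perm sq i e _).trans ((ih q).cons i)

theorem Sorted.mul {w x v : V} (p : E.EdgePath w x) {q : E.EdgePath x v} (hq : q.Sorted) :
    (mul sq p q).Sorted := by
  induction p with
  | nil => exact hq
  | cons i e p ih => exact (ih hq).insert sq i e

theorem sorted_nil (v : V) : (nil v : E.EdgePath v v).Sorted := List.Pairwise.nil

/-- Multiplying by the empty path sorts by insertion. In a sorted path no inserted edge meets a
larger colour, so nothing moves. -/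
theorem Sorted.mul_nil {w v : V} {p : E.EdgePath w v} (hp : p.Sorted) :
    EdgePath.mul sq p (nil v) = p := by
  induction p with
  | nil => rfl
  | cons i e p ih =>
    rw [Sorted, colours, List.pairwise_cons] at hp
    rw [cons_mul, ih hp.2]
    cases p with
    | nil => rfl
    | cons j f p => exact insert_cons_of_not_lt sq (not_lt.2 (hp.1 j (by simp [colours]))) _ _ _

theorem append_mul {w x y v : V} (p : E.EdgePath w x) (q : E.EdgePath x y) (r : E.EdgePath y v) :
    mul sq (p.append q) r = mul sq p (mul sq q r) := by
  induction p with
  | nil => rfl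
  | cons i e p ih => rw [append, cons_mul, ih, cons_mul]

variable {sq}

theorem insert_mul (hsq : E.IsAssociative sq) {w x y v : V} (i : Fin k) (e : E.Edge i w x)
    (p : E.EdgePath x y) (q : E.EdgePath y v) :
    mul sq (insert sq i e p) q = insert sq i e (mul sq p q) := by
  induction p generalizing w with
  | nil => rfl
  | cons j f p ih =>
    by_cases h : i < j
    · rw [insert_cons_of_lt sq h, cons_mul, ih, cons_mul, ← insert_insert sq hsq h ⟨_, e, f⟩]
    · rw [insert_cons_of_not_lt sq h, cons_mul]

theorem mul_mul (hsq : E.IsAssociative sq) {w x y v : V} (p : E.EdgePath w x) (q : E.EdgePath x y)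
    (r : E.EdgePath y v) : mul sq (mul sq p q) r = mul sq p (mul sq q r) := by
  induction p with
  | nil => rfl
  | cons i e p ih => rw [cons_mul, insert_mul hsq, ih, cons_mul]

/-- Paths with the same word of colours are determined by their sorted forms. -/
theorem eq_of_mul_nil_eq {w v : V} (p p' : E.EdgePath w v) (hc : p.colours = p'.colours)
    (h : mul sq p (nil v) = mul sq p' (nil v)) : p = p' := by
  induction p with
  | nil =>
    cases p' with
    | nil => rfl
    | cons => simp [colours] at hc
  | cons i e p ih =>
    cases p' with
    | nil => simp [colours] at hc
    | cons i' e' p' =>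
      simp only [colours, List.cons.injEq] at hc
      obtain ⟨rfl, hc⟩ := hc
      -- Two sorted words with the same letters are equal, so the tails satisfy the colour
      -- hypothesis of `insert_injective`.
      have hcol : (mul sq p (nil _)).colours = (mul sq p' (nil _)).colours := by
        refine List.Perm.eq_of_pairwise' (r := (· ≥ ·)) ((sorted_nil _).mul sq p)
          ((sorted_nil _).mul sq p') ?_
        refine (colours_mul_perm sq _ _).trans (.trans ?_ (colours_mul_perm sq _ _).symm)
        rw [hc]
      have := insert_injective sq i e e' _ _ hcol h
      simp only [Sigma.mk.injEq] at this
      obtain ⟨rfl, h2⟩ := this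
      simp only [heq_eq_eq, Prod.mk.injEq] at h2
      obtain ⟨rfl, h2⟩ := h2
      rw [ih p' hc h2]

/-- The colours of a path can be permuted arbitrarily without changing the sorted form. -/
theorem exists_colours_eq (hsq : E.IsAssociative sq) {c d : List (Fin k)} (h : c.Perm d)
    {w v : V} (p : E.EdgePath w v) (hp : p.colours = c) :
    ∃ q : E.EdgePath w v, q.colours = d ∧ mul sq q (nil v) = mul sq p (nil v) := by
  induction h generalizing w v with
  | nil => exact ⟨p, hp, rfl⟩
  | cons i _ ih =>
    cases p with
    | nil => simp [colours] at hp
    | cons j e p =>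
      simp only [colours, List.cons.injEq] at hp
      obtain ⟨rfl, hp⟩ := hp
      obtain ⟨q, hq, h⟩ := ih p hp
      exact ⟨cons j e q, by simp [colours, hq], by rw [cons_mul, h, cons_mul]⟩
  | swap i j c =>
    cases p with
    | nil => simp [colours] at hp
    | cons j' e p =>
      cases p with
      | nil => simp [colours] at hp
      | cons i' f p =>
        simp only [colours, List.cons.injEq] at hp
        obtain ⟨rfl, rfl, hp⟩ := hp
        -- A square exists only for colours `i < j`: an ascending pair is exchanged by the square, a
        -- descending one by its inverse, and equal colours need no exchange.
        rcases lt_trichotomy j' i' with h | rfl | h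
        · exact ⟨cons i' (sq j' i' h _ _ ⟨_, e, f⟩).2.1 (cons j' (sq j' i' h _ _ ⟨_, e, f⟩).2.2 p),
            by simp [colours, hp], (insert_insert sq hsq h ⟨_, e, f⟩ _).symm⟩
        · exact ⟨_, by simp [colours, hp], rfl⟩
        · refine ⟨cons i' ((sq i' j' h _ _).symm ⟨_, e, f⟩).2.1
              (cons j' ((sq i' j' h _ _).symm ⟨_, e, f⟩).2.2 p), by simp [colours, hp],
            (insert_insert sq hsq h ((sq i' j' h _ _).symm ⟨_, e, f⟩) _).trans ?_⟩
          rw [Equiv.apply_symm_apply]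
          rfl
  | trans _ _ ih₁ ih₂ =>
    obtain ⟨q, hq, h⟩ := ih₁ p hp
    obtain ⟨q', hq', h'⟩ := ih₂ q hq
    exact ⟨q', hq', h'.trans h⟩

/-- The degree of a path. -/
def degree {w v : V} (p : E.EdgePath w v) : Fin k → ℕ := fun i => p.colours.count i

theorem degree_eq_iff {w v x y : V} {p : E.EdgePath w v} {q : E.EdgePath x y} :
    p.degree = q.degree ↔ p.colours.Perm q.colours := by
  rw [List.perm_iff_count, funext_iff]
  rfl

theorem degree_append {w x v : V} (p : E.EdgePath w x) (q : E.EdgePath x v) :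
    (p.append q).degree = p.degree + q.degree := by
  ext i
  simp [degree]

theorem degree_mul {w x v : V} (p : E.EdgePath w x) (q : E.EdgePath x v) :
    (mul sq p q).degree = p.degree + q.degree := by
  rw [← degree_append, degree_eq_iff, colours_append]
  exact colours_mul_perm sq p q

theorem Sorted.colours_eq {w v x y : V} {p : E.EdgePath w v} {q : E.EdgePath x y} (hp : p.Sorted)
    (hq : q.Sorted) (h : p.degree = q.degree) : p.colours = q.colours :=
  List.Perm.eq_of_pairwise' hp hq (degree_eq_iff.1 h)

/-- The list of edges of a path. -/
def edges {w v : V} : E.EdgePath w v → List (Σ i w v, E.Edge i w v)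
  | nil _ => []
  | cons i e p => ⟨i, _, _, e⟩ :: p.edges

/-- Serves to make the set of paths countable. -/
theorem edges_injective {w v : V} :
    Function.Injective (edges : E.EdgePath w v → List (Σ i w v, E.Edge i w v)) := by
  intro p q h
  induction p with
  | nil =>
    cases q with
    | nil => rfl
    | cons => simp [edges] at h
  | cons i e p ih =>
    cases q with
    | nil => simp [edges] at h
    | cons j f q =>
      rw [edges, edges, List.cons.injEq] at h
      obtain ⟨h, h'⟩ := h
      cases h
      rw [ih h']

instance [Countable V] [∀ i w v, Countable (E.Edge i w v)] (w v : V) :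
    Countable (E.EdgePath w v) :=
  edges_injective.countable

end EdgePath

theorem exists_sorted_word (n : Fin k → ℕ) :
    ∃ c : List (Fin k), c.Pairwise (· ≥ ·) ∧ ∀ i, c.count i = n i := by
  refine ⟨(∑ i, Multiset.replicate (n i) i).sort (· ≥ ·), Multiset.pairwise_sort _ _, fun i => ?_⟩
  rw [← Multiset.coe_count, Multiset.sort_eq, Multiset.count_sum']
  simp [Multiset.count_replicate]

open EdgePath in
/-- The `k`-graph of a coloured graph with commuting squares: its paths are the sorted paths of the
coloured graph. -/
def toKGraph (sq : E.Squares) (hsq : E.IsAssociative sq) [Countable V]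
    [∀ i w v, Countable (E.Edge i w v)] : KGraph.{u} k where
  Vertex := V
  category :=
    { Hom := fun a b => {p : E.EdgePath b a // p.Sorted}
      id := fun a => ⟨nil a, sorted_nil a⟩
      comp := fun q p => ⟨mul sq p.1 q.1, q.2.mul sq p.1⟩
      id_comp := fun p => Subtype.ext (p.2.mul_nil sq)
      comp_id := fun _ => rfl
      assoc := fun r q p => Subtype.ext (mul_mul hsq p.1 q.1 r.1).symm }
  countable := (inferInstance : Countable (Σ a b : V, {p : E.EdgePath b a // p.Sorted}))
  deg p := p.1.degree
  deg_id _ := rfl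
  deg_comp _ _ := degree_mul _ _
  factorization := by
    intro a b p m n h
    obtain ⟨c, hc, hcm⟩ := exists_sorted_word m
    obtain ⟨d, hd, hdn⟩ := exists_sorted_word n
    -- Existence: rearrange the colours of `p` into the sorted word of `m` followed by that of `n`,
    -- and cut there.
    obtain ⟨q, hq, hqp⟩ := exists_colours_eq hsq (d := c ++ d) (by
      rw [List.perm_iff_count]
      intro i
      rw [List.count_append, hcm, hdn]
      exact congrFun h i) p.1 rfl
    obtain ⟨x, μ, ν, rfl, rfl, rfl⟩ := exists_append q c d hq
    rw [append_mul, Sorted.mul_nil sq (p := ν) hd, Sorted.mul_nil sq p.2] at hqp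
    refine ⟨⟨x, ⟨μ, hc⟩, ⟨ν, hd⟩⟩, ⟨Subtype.ext hqp, funext hcm, funext hdn⟩, ?_⟩
    rintro ⟨x', μ', ν'⟩ ⟨hp', hm', hn'⟩
    have hμ : μ'.1.colours = μ.colours := μ'.2.colours_eq hc (hm'.trans (funext hcm).symm)
    have hν : ν'.1.colours = ν.colours := ν'.2.colours_eq hd (hn'.trans (funext hdn).symm)
    have hp'' : mul sq μ'.1 ν'.1 = p.1 := congrArg Subtype.val hp'
    -- Uniqueness: both concatenations have the colour word `c ++ d` and sorted form `p`, so they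
    -- coincide, and they are cut at the same place.
    have := eq_of_append_eq μ'.1 μ ν'.1 ν hμ <| eq_of_mul_nil_eq (sq := sq) _ _
      (by simp [hμ, hν]) (by
        rw [append_mul, append_mul, Sorted.mul_nil sq ν'.2, Sorted.mul_nil sq (p := ν) hd, hp'', hqp])
    obtain ⟨μ', hμ'⟩ := μ'
    obtain ⟨ν', hν'⟩ := ν'
    cases this
    rfl

end ColouredGraph

/-! ### Evaluation of edge paths in an arbitrary realization -/

namespace ColouredGraph

variable {k : ℕ} {V : Type u} {E : ColouredGraph k V}

namespace EdgePath

theorem degree_cons {w x v : V} (i : Fin k) (e : E.Edge i w x) (p : E.EdgePath x v) :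
    (cons i e p).degree = Pi.single i 1 + p.degree := by
  ext j
  simp only [degree, colours, List.count_cons, Pi.add_apply, Pi.single_apply, beq_iff_eq]
  rw [add_comm]
  simp only [eq_comm]

theorem sorted_edge {w v : V} (i : Fin k) (e : E.Edge i w v) : (cons i e (nil v)).Sorted :=
  List.pairwise_singleton _ _

theorem exists_eq_edge {w v : V} {i : Fin k} (p : E.EdgePath w v)
    (h : p.degree = Pi.single i 1) : ∃ e : E.Edge i w v, cons i e (nil v) = p := by
  have hc : p.colours = [i] := by
    rw [← List.perm_singleton, List.perm_iff_count]
    intro j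
    refine (congrFun h j).trans ?_
    by_cases hj : j = i
    · subst hj; simp
    · simp [hj, Ne.symm hj]
  cases p with
  | nil => simp [colours] at hc
  | cons j e p =>
    simp only [colours, List.cons.injEq] at hc
    obtain ⟨rfl, hc⟩ := hc
    cases p with
    | nil => exact ⟨e, rfl⟩
    | cons => simp [colours] at hc

end EdgePath

open EdgePath

/-- The paths of degree `εᵢ` in the `k`-graph `toKGraph` are the edges of colour `i`. -/
noncomputable def toKGraphRealization (sq : E.Squares) (hsq : E.IsAssociative sq) [Countable V]
    [∀ i w v, Countable (E.Edge i w v)] : E.Realization sq (E.toKGraph sq hsq) where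
  vertex := Equiv.refl V
  edge i w v := Equiv.ofBijective
    (fun e => ⟨⟨cons i e (nil v), sorted_edge i e⟩, by
      exact (degree_cons i e _).trans (add_zero _)⟩) (by
    refine ⟨fun e f h => ?_, fun ⟨p, hp⟩ => ?_⟩
    · have : cons i e (nil v) = cons i f (nil v) := congrArg (fun q => q.1.1) h
      cases this
      rfl
    · obtain ⟨e, he⟩ := exists_eq_edge p.1 hp
      exact ⟨e, Subtype.ext (Subtype.ext he)⟩)
  square i j hij w v q := by
    refine Subtype.ext ?_
    change mul sq (cons i q.2.1 (nil _)) (cons j q.2.2 (nil _)) =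
      mul sq (cons j (sq i j hij w v q).2.1 (nil _)) (cons i (sq i j hij w v q).2.2 (nil _))
    -- Insertion into the empty path is the defining relation `ef = f'e'`.
    exact insert_insert sq hsq hij q (nil v)

section

variable {sq : E.Squares} {Λ : KGraph.{u} k} (P : E.Realization sq Λ)

/-- The path in a `k`-graph given by a path in its skeleton. -/
def Realization.eval {w v : V} : E.EdgePath w v → (P.vertex v ⟶ P.vertex w)
  | nil _ => 𝟙 _
  | cons i e p => Realization.eval p ≫ (P.edge i _ _ e).1

@[simp] theorem Realization.eval_nil (v : V) : P.eval (nil v) = 𝟙 _ := rfl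

@[simp] theorem Realization.eval_cons {w x v : V} (i : Fin k) (e : E.Edge i w x)
    (p : E.EdgePath x v) : P.eval (cons i e p) = P.eval p ≫ (P.edge i _ _ e).1 := rfl

theorem Realization.eval_insert {w x v : V} (i : Fin k) (e : E.Edge i w x)
    (p : E.EdgePath x v) : P.eval (insert sq i e p) = P.eval p ≫ (P.edge i _ _ e).1 := by
  induction p generalizing w with
  | nil => rfl
  | cons j f p ih =>
    by_cases h : i < j
    · rw [insert_cons_of_lt sq h, eval_cons, ih, eval_cons, Category.assoc, Category.assoc,
        P.square i j h _ _ ⟨_, e, f⟩]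
    · rw [insert_cons_of_not_lt sq h, eval_cons]

theorem Realization.eval_mul {w x v : V} (p : E.EdgePath w x) (q : E.EdgePath x v) :
    P.eval (mul sq p q) = P.eval q ≫ P.eval p := by
  induction p with
  | nil => simp
  | cons i e p ih => rw [cons_mul, eval_insert, ih, eval_cons, Category.assoc]

@[simp] theorem Realization.deg_eval {w v : V} (p : E.EdgePath w v) :
    Λ.deg (P.eval p) = p.degree := by
  induction p with
  | nil => exact Λ.deg_id _
  | cons i e p ih => rw [eval_cons, Λ.deg_comp, ih, (P.edge i _ _ e).2, degree_cons]

/-- Induction on the total degree: some coordinate is nonzero, and the factorization property splits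
off an edge of that colour. -/
theorem Realization.exists_eval_eq {w v : V} (p : P.vertex v ⟶ P.vertex w) :
    ∃ q : E.EdgePath w v, P.eval q = p := by
  induction h : ∑ i, Λ.deg p i generalizing w with
  | zero =>
    have h0 : Λ.deg p = 0 := funext fun i => (Finset.sum_eq_zero_iff.1 h) i (Finset.mem_univ i)
    -- A path of degree `0` is an identity: composing it with an identity on either side gives two
    -- factorizations of degrees `0 + 0`, which must agree.
    obtain ⟨q, -, hq⟩ := Λ.factorization p 0 0 (by simpa using h0)
    have := (hq ⟨P.vertex w, 𝟙 _, p⟩ ⟨Category.comp_id _, Λ.deg_id _, h0⟩).trans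
      (hq ⟨P.vertex v, p, 𝟙 _⟩ ⟨Category.id_comp _, h0, Λ.deg_id _⟩).symm
    simp only [Sigma.mk.injEq] at this
    obtain ⟨hwv, this⟩ := this
    obtain rfl := P.vertex.injective hwv
    simp only [heq_eq_eq, Prod.mk.injEq] at this
    exact ⟨nil w, this.1⟩
  | succ N ih =>
    obtain ⟨i, -, hi⟩ : ∃ i ∈ Finset.univ, Λ.deg p i ≠ 0 :=
      Finset.exists_ne_zero_of_sum_ne_zero (by omega)
    have hd : Λ.deg p = Pi.single i 1 + (Λ.deg p - Pi.single i 1) := by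
      ext j
      by_cases hj : j = i
      · subst hj; simp; omega
      · simp [hj]
    obtain ⟨⟨c, μ, ν⟩, ⟨hp, hμ, hν⟩, -⟩ := Λ.factorization p _ _ hd
    obtain ⟨x, rfl⟩ := P.vertex.surjective c
    obtain ⟨e, he⟩ := (P.edge i w x).surjective ⟨μ, hμ⟩
    obtain ⟨q, hq⟩ := ih ν (by
      simp only at hν
      rw [hd] at h
      simp only [Pi.add_apply, Finset.sum_add_distrib, ← hν] at h
      rw [Finset.sum_pi_single'] at h
      simp at h
      omega)
    exact ⟨cons i e q, by rw [eval_cons, hq, he]; exact hp⟩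

/-- Unique factorization recovers the leading edge and the remaining path from the value, since
equal colour words fix the degrees of both. -/
theorem Realization.eq_of_eval_eq {w v : V} (p q : E.EdgePath w v) (hc : p.colours = q.colours)
    (h : P.eval p = P.eval q) : p = q := by
  induction p with
  | nil =>
    cases q with
    | nil => rfl
    | cons => simp [colours] at hc
  | cons i e p ih =>
    cases q with
    | nil => simp [colours] at hc
    | cons j f q =>
      have hc' := hc
      simp only [colours, List.cons.injEq] at hc
      obtain ⟨rfl, hc⟩ := hc
      obtain ⟨r, -, hr⟩ := Λ.factorization (P.eval (cons i e p)) (Pi.single i 1) p.degree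
        ((P.deg_eval _).trans (degree_cons _ _ _))
      have := (hr ⟨_, (P.edge i _ _ e).1, P.eval p⟩ ⟨rfl, (P.edge i _ _ e).2, P.deg_eval p⟩).trans
        (hr ⟨_, (P.edge i _ _ f).1, P.eval q⟩ ⟨h.symm, (P.edge i _ _ f).2, by
          simp only [deg_eval, degree_eq_iff, hc]; rfl⟩).symm
      simp only [Sigma.mk.injEq] at this
      obtain ⟨hwv, this⟩ := this
      obtain rfl := P.vertex.injective hwv
      simp only [heq_eq_eq, Prod.mk.injEq] at this
      obtain rfl := (P.edge i _ _).injective (Subtype.ext this.1)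
      rw [ih q hc this.2]

theorem Realization.bijective_eval (w v : V) :
    Function.Bijective fun p : {p : E.EdgePath w v // p.Sorted} => P.eval p.1 := by
  refine ⟨fun p q h => Subtype.ext (P.eq_of_eval_eq _ _ ?_ h), fun p => ?_⟩
  · refine p.2.colours_eq q.2 ?_
    rw [← P.deg_eval, ← P.deg_eval]
    exact congrArg Λ.deg h
  · obtain ⟨q, rfl⟩ := P.exists_eval_eq p
    exact ⟨⟨mul sq q (nil v), (sorted_nil v).mul sq q⟩, by simp [eval_mul]⟩

/-- Every `k`-graph with a given skeleton and given commuting squares is isomorphic to the one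
constructed from them. -/
def Realization.isoOfToKGraph [Countable V] [∀ i w v, Countable (E.Edge i w v)]
    (hsq : E.IsAssociative sq) : KGraph.Iso (E.toKGraph sq hsq) Λ where
  toFunctor :=
    { obj := P.vertex
      map := fun p => P.eval p.1
      map_id := fun _ => rfl
      map_comp := fun _ _ => P.eval_mul _ _ }
  bijective_obj := P.vertex.bijective
  bijective_map a b := P.bijective_eval b a
  deg_map p := P.deg_eval p.1

theorem Realization.compatible_isoOfToKGraph [Countable V] [∀ i w v, Countable (E.Edge i w v)]
    (hsq : E.IsAssociative sq) :
    (toKGraphRealization sq hsq).Compatible P (P.isoOfToKGraph hsq) := by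
  refine ⟨fun _ => rfl, fun i w v e => ?_⟩
  have : (P.isoOfToKGraph hsq).toFunctor.map ((toKGraphRealization sq hsq).edge i w v e).1 =
      (P.edge i w v e).1 := Category.id_comp _
  rw [this]
  rfl

end

end ColouredGraph

/-! ### Composites and inverses of isomorphisms -/

namespace KGraph.Iso

variable {k : ℕ} {Λ Λ' Λ'' : KGraph.{u} k}

/-- Composition of isomorphisms of `k`-graphs. -/
def trans (Φ : Iso Λ Λ') (Ψ : Iso Λ' Λ'') : Iso Λ Λ'' where
  toFunctor := Φ.toFunctor ⋙ Ψ.toFunctor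
  bijective_obj := Ψ.bijective_obj.comp Φ.bijective_obj
  bijective_map a b := (Ψ.bijective_map _ _).comp (Φ.bijective_map a b)
  deg_map p := (Ψ.deg_map _).trans (Φ.deg_map p)

theorem deg_eqToHom {a b : Λ.Vertex} (h : a = b) : Λ.deg (eqToHom h) = 0 := by
  subst h; exact Λ.deg_id _

/-- The vertex of `Λ` over a vertex of `Λ'`. -/
noncomputable def symmObj (Φ : Iso Λ Λ') (a : Λ'.Vertex) : Λ.Vertex := (Φ.bijective_obj.2 a).choose

theorem obj_symmObj (Φ : Iso Λ Λ') (a : Λ'.Vertex) : Φ.toFunctor.obj (Φ.symmObj a) = a :=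
  (Φ.bijective_obj.2 a).choose_spec

theorem symmObj_obj (Φ : Iso Λ Λ') (a : Λ.Vertex) : Φ.symmObj (Φ.toFunctor.obj a) = a :=
  Φ.bijective_obj.1 (Φ.obj_symmObj _)

/-- The path of `Λ` over a path of `Λ'`. -/
noncomputable def symmMap (Φ : Iso Λ Λ') {a b : Λ'.Vertex} (p : a ⟶ b) :
    Φ.symmObj a ⟶ Φ.symmObj b :=
  ((Φ.bijective_map _ _).2
    (eqToHom (Φ.obj_symmObj a) ≫ p ≫ eqToHom (Φ.obj_symmObj b).symm)).choose

theorem map_symmMap (Φ : Iso Λ Λ') {a b : Λ'.Vertex} (p : a ⟶ b) :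
    Φ.toFunctor.map (Φ.symmMap p) =
      eqToHom (Φ.obj_symmObj a) ≫ p ≫ eqToHom (Φ.obj_symmObj b).symm :=
  ((Φ.bijective_map _ _).2
    (eqToHom (Φ.obj_symmObj a) ≫ p ≫ eqToHom (Φ.obj_symmObj b).symm)).choose_spec

/-- The inverse of an isomorphism of `k`-graphs. -/
noncomputable def symm (Φ : Iso Λ Λ') : Iso Λ' Λ where
  toFunctor :=
    { obj := Φ.symmObj
      map := Φ.symmMap
      map_id := fun a => (Φ.bijective_map _ _).1 (by simp [map_symmMap])
      map_comp := fun p q => (Φ.bijective_map _ _).1 (by simp [map_symmMap]) }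
  bijective_obj :=
    ⟨fun a b h => ((Φ.obj_symmObj a).symm.trans (congrArg Φ.toFunctor.obj h)).trans
        (Φ.obj_symmObj b),
      fun a => ⟨_, Φ.symmObj_obj a⟩⟩
  bijective_map a b := by
    refine ⟨fun p q h => ?_, fun p => ?_⟩
    · have := congrArg Φ.toFunctor.map h
      simp only [map_symmMap] at this
      exact (cancel_mono _).1 ((cancel_epi _).1 this)
    · refine ⟨eqToHom (Φ.obj_symmObj a).symm ≫ Φ.toFunctor.map p ≫ eqToHom (Φ.obj_symmObj b),
        (Φ.bijective_map _ _).1 ?_⟩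
      simp [map_symmMap]
  deg_map p := by
    rw [← Φ.deg_map]
    simp [map_symmMap, Λ'.deg_comp, deg_eqToHom]

/-- Stated in the sigma type because the endpoints after the round trip equal `a` and `b` only
propositionally. -/
theorem symm_map_map (Φ : Iso Λ Λ') {a b : Λ.Vertex} (p : a ⟶ b) :
    (⟨_, _, Φ.symm.toFunctor.map (Φ.toFunctor.map p)⟩ : Σ a b : Λ.Vertex, (a ⟶ b)) =
      ⟨a, b, p⟩ := by
  have key : ∀ (c d : Λ.Vertex) (q : c ⟶ d) (hc : c = a) (hd : d = b),
      q = eqToHom hc ≫ p ≫ eqToHom hd.symm →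
      (⟨c, d, q⟩ : Σ a b : Λ.Vertex, (a ⟶ b)) = ⟨a, b, p⟩ := by
    rintro c d q rfl rfl rfl
    simp
  refine key (Φ.symmObj _) (Φ.symmObj _) (Φ.symmMap (Φ.toFunctor.map p)) (Φ.symmObj_obj a)
    (Φ.symmObj_obj b) ((Φ.bijective_map _ _).1 ?_)
  simp only [map_symmMap, Functor.map_comp, eqToHom_map]

end KGraph.Iso

/-- Used with `Λ` the `k`-graph of sorted paths, through which any two realizations are compared. -/
theorem ColouredGraph.Realization.Compatible.symm_trans {k : ℕ} {V : Type u}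
    {E : ColouredGraph k V} {sq : E.Squares} {Λ Λ' Λ'' : KGraph.{u} k} {P : E.Realization sq Λ}
    {P' : E.Realization sq Λ'} {P'' : E.Realization sq Λ''} {Φ : KGraph.Iso Λ Λ'}
    {Ψ : KGraph.Iso Λ Λ''} (hΦ : P.Compatible P' Φ) (hΨ : P.Compatible P'' Ψ) :
    P'.Compatible P'' (Φ.symm.trans Ψ) := by
  refine ⟨fun v => ?_, fun i w v e => ?_⟩
  · rw [← hΨ.1 v, ← hΦ.1 v]
    exact congrArg Ψ.toFunctor.obj (Φ.symmObj_obj _)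
  · rw [← hΨ.2 i w v e]
    have key : ∀ t t' : Σ a b : Λ'.Vertex, (a ⟶ b), t = t' →
        (⟨_, _, (Φ.symm.trans Ψ).toFunctor.map t.2.2⟩ : Σ a b : Λ''.Vertex, (a ⟶ b)) =
          ⟨_, _, (Φ.symm.trans Ψ).toFunctor.map t'.2.2⟩ := by
      rintro t _ rfl; rfl
    refine (key _ _ (hΦ.2 i w v e).symm).trans ?_
    exact congrArg (fun t : Σ a b : Λ.Vertex, (a ⟶ b) =>
      (⟨_, _, Ψ.toFunctor.map t.2.2⟩ : Σ a b : Λ''.Vertex, (a ⟶ b)))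
      (Φ.symm_map_map (P.edge i w v e).1)

/-! ### Properties of the `k`-graph read off its coloured graph -/

namespace ColouredGraph

variable {k : ℕ} {V : Type u} {E : ColouredGraph k V}

namespace EdgePath

theorem exists_colours_eq_word (h : ∀ i w, ∃ v, Nonempty (E.Edge i w v)) (c : List (Fin k))
    (w : V) : ∃ (v : V) (p : E.EdgePath w v), p.colours = c := by
  induction c generalizing w with
  | nil => exact ⟨w, nil w, rfl⟩
  | cons i c ih =>
    obtain ⟨x, ⟨e⟩⟩ := h i w
    obtain ⟨v, p, rfl⟩ := ih x
    exact ⟨v, cons i e p, rfl⟩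

theorem finite_colours_eq_range (h : ∀ i w, Finite (Σ v, E.Edge i w v)) (c : List (Fin k))
    (w : V) : Finite (Σ v, {p : E.EdgePath w v // p.colours = c}) := by
  induction c generalizing w with
  | nil =>
    refine @Finite.of_surjective Unit _ _ (fun _ => ⟨w, nil w, rfl⟩) ?_
    rintro ⟨v, p, hp⟩
    cases p with
    | nil => exact ⟨(), rfl⟩
    | cons => simp [colours] at hp
  | cons i c ih =>
    have := h i w
    refine Finite.of_surjective
      (fun t : Σ e : (Σ x, E.Edge i w x), Σ v, {p : E.EdgePath e.1 v // p.colours = c} =>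
        (⟨t.2.1, cons i t.1.2 t.2.2.1, by simp [colours, t.2.2.2]⟩ :
          Σ v, {p : E.EdgePath w v // p.colours = i :: c})) ?_
    rintro ⟨v, p, hp⟩
    cases p with
    | nil => simp [colours] at hp
    | cons j e p =>
      obtain ⟨rfl, hp'⟩ := List.cons.inj hp
      exact ⟨⟨⟨_, e⟩, v, p, hp'⟩, rfl⟩

theorem finite_colours_eq_source (h : ∀ i v, Finite (Σ w, E.Edge i w v)) (c : List (Fin k))
    (v : V) : Finite (Σ w, {p : E.EdgePath w v // p.colours = c}) := by
  induction c with
  | nil =>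
    refine @Finite.of_surjective Unit _ _ (fun _ => ⟨v, nil v, rfl⟩) ?_
    rintro ⟨w, p, hp⟩
    cases p with
    | nil => exact ⟨(), rfl⟩
    | cons => simp [colours] at hp
  | cons i c ih =>
    refine Finite.of_surjective
      (fun t : Σ p : (Σ x, {p : E.EdgePath x v // p.colours = c}), Σ w, E.Edge i w p.1 =>
        (⟨t.2.1, cons i t.2.2 t.1.2.1, by simp [colours, t.1.2.2]⟩ :
          Σ w, {p : E.EdgePath w v // p.colours = i :: c})) ?_
    rintro ⟨w, p, hp⟩
    cases p with
    | nil => simp [colours] at hp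
    | cons j e p =>
      obtain ⟨rfl, hp'⟩ := List.cons.inj hp
      exact ⟨⟨⟨_, p, hp'⟩, w, e⟩, rfl⟩

end EdgePath

open EdgePath

variable {sq : E.Squares} {Λ : KGraph.{u} k}

theorem Realization.noSources (P : E.Realization sq Λ)
    (h : ∀ i w, ∃ v, Nonempty (E.Edge i w v)) : Λ.NoSources := by
  intro a n
  obtain ⟨w, rfl⟩ := P.vertex.surjective a
  obtain ⟨c, -, hc⟩ := exists_sorted_word n
  obtain ⟨v, p, rfl⟩ := exists_colours_eq_word h c w
  exact ⟨⟨P.vertex v, P.eval p, (P.deg_eval p).trans (funext hc)⟩⟩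

theorem Realization.exists_sorted_eval_eq (P : E.Realization sq Λ) {w v : V}
    (p : P.vertex v ⟶ P.vertex w)
    {c : List (Fin k)} (hc : c.Pairwise (· ≥ ·)) (hcp : ∀ i, c.count i = Λ.deg p i) :
    ∃ q : E.EdgePath w v, q.colours = c ∧ P.eval q = p := by
  obtain ⟨q, rfl⟩ := (P.bijective_eval w v).2 p
  refine ⟨q.1, List.Perm.eq_of_pairwise' q.2 hc ?_, rfl⟩
  rw [List.perm_iff_count]
  intro i
  rw [hcp, P.deg_eval]
  rfl

theorem Realization.locallyFinite (P : E.Realization sq Λ) (hr : ∀ i w, Finite (Σ v, E.Edge i w v))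
    (hs : ∀ i v, Finite (Σ w, E.Edge i w v)) : Λ.LocallyFinite := by
  intro a n
  obtain ⟨w, rfl⟩ := P.vertex.surjective a
  obtain ⟨c, hc, hcn⟩ := exists_sorted_word n
  have h₁ := finite_colours_eq_range hr c w
  have h₂ := finite_colours_eq_source hs c w
  constructor
  · refine Finite.of_surjective (fun t : Σ v, {p : E.EdgePath w v // p.colours = c} =>
      (⟨P.vertex t.1, P.eval t.2.1, by
        rw [deg_eval]
        ext i
        rw [← hcn, degree]
        exact congrArg _ t.2.2⟩ : Σ b, {p : b ⟶ P.vertex w // Λ.deg p = n})) ?_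
    rintro ⟨b, p, hp⟩
    obtain ⟨v, rfl⟩ := P.vertex.surjective b
    obtain ⟨q, hq, rfl⟩ := P.exists_sorted_eval_eq p hc fun i => by rw [hcn, hp]
    exact ⟨⟨v, q, hq⟩, rfl⟩
  · refine Finite.of_surjective (fun t : Σ v, {p : E.EdgePath v w // p.colours = c} =>
      (⟨P.vertex t.1, P.eval t.2.1, by
        rw [deg_eval]
        ext i
        rw [← hcn, degree]
        exact congrArg _ t.2.2⟩ : Σ b, {p : P.vertex w ⟶ b // Λ.deg p = n})) ?_
    rintro ⟨b, p, hp⟩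
    obtain ⟨v, rfl⟩ := P.vertex.surjective b
    obtain ⟨q, hq, rfl⟩ := P.exists_sorted_eval_eq p hc fun i => by rw [hcn, hp]
    exact ⟨⟨v, q, hq⟩, rfl⟩

theorem Realization.cofinal (P : E.Realization sq Λ)
    (h : ∀ w v, Nonempty (E.EdgePath w v)) : Λ.Cofinal := by
  intro x b
  obtain ⟨w, rfl⟩ := P.vertex.surjective b
  obtain ⟨v, hv⟩ := P.vertex.surjective (x.obj 0)
  obtain ⟨p⟩ := h w v
  -- Any two vertices are connected, so the starting vertex `x(0)` already works.
  exact ⟨0, hv ▸ ⟨P.eval p⟩⟩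

end ColouredGraph

/-! ### Irreducible constituents of unitary representations -/

open Representation

section Irreducible

variable {G : Type u} [Group G] [TopologicalSpace G]

instance (x : UnitaryDual G) : x.rep.IsIrreducible := (Quotient.out x).irreducible

theorem UnitaryDual.eq_of_intertwiningMap_ne_zero {x y : UnitaryDual G}
    (f : IntertwiningMap x.rep y.rep) (hf : f ≠ 0) : x = y :=
  Quotient.out_equiv_out.1
    ⟨f.ofBijective ((IsIrreducible.bijective_or_eq_zero f).resolve_right hf)⟩

instance (x : UnitaryDual G) : Nontrivial (EuclideanSpace ℂ (Fin (Quotient.out x).dim)) :=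
  (IsSimpleModule.nontrivial (MonoidAlgebra ℂ G) x.rep.asModule :)

open scoped MonoidAlgebra in
/-- Only finitely many irreducible representations occur in a finite-dimensional one. -/
theorem finite_constituents {V : Type*} [AddCommGroup V] [Module ℂ V] [FiniteDimensional ℂ V]
    (τ : Representation ℂ G V) :
    {x : UnitaryDual G | ∃ f : IntertwiningMap x.rep τ, f ≠ 0}.Finite := by
  have hN : IsNoetherian ℂ[G] τ.asModule := by
    have : FiniteDimensional ℂ τ.asModule := inferInstanceAs (FiniteDimensional ℂ V)
    exact isNoetherian_of_tower ℂ inferInstance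
  choose f hf using fun x : {x : UnitaryDual G | ∃ f : IntertwiningMap x.rep τ, f ≠ 0} => x.2
  have hinj : ∀ x, Function.Injective (IntertwiningMap.equivLinearMapAsModule _ _ (f x)) :=
    fun x => (IsIrreducible.injective_or_eq_zero (f x)).resolve_right (hf x)
  let S : {x : UnitaryDual G | ∃ f : IntertwiningMap x.rep τ, f ≠ 0} → Submodule ℂ[G] τ.asModule :=
    fun x => LinearMap.range (IntertwiningMap.equivLinearMapAsModule _ _ (f x))
  let e : ∀ x, x.1.rep.asModule ≃ₗ[ℂ[G]] S x := fun x => LinearEquiv.ofInjective _ (hinj x)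
  have hS : ∀ x, IsSimpleModule ℂ[G] (S x) := fun x => IsSimpleModule.congr (e x).symm
  -- The map to isotypic components has a finite target, by Noetherianity. It is injective because
  -- simple submodules in one isotypic component are isomorphic.
  let c : {x : UnitaryDual G | ∃ f : IntertwiningMap x.rep τ, f ≠ 0} →
      isotypicComponents ℂ[G] τ.asModule :=
    fun x => ⟨isotypicComponent ℂ[G] τ.asModule (S x), S x, hS x, rfl⟩
  have hc : Function.Injective c := by
    intro x y hxy
    have hle : S x ≤ isotypicComponent ℂ[G] τ.asModule (S y) :=
      (S x).le_isotypicComponent.trans (congrArg Subtype.val hxy).le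
    obtain ⟨t⟩ := isIsotypicOfType_submodule_iff.1
      (IsIsotypicOfType.isotypicComponent ℂ[G] τ.asModule (S y)) _ hle
    let φ : x.1.rep.asModule ≃ₗ[ℂ[G]] y.1.rep.asModule := ((e x).trans t).trans (e y).symm
    refine Subtype.ext (UnitaryDual.eq_of_intertwiningMap_ne_zero
      ((IntertwiningMap.equivLinearMapAsModule x.1.rep y.1.rep).symm φ.toLinearMap) fun h => ?_)
    rw [LinearEquiv.map_eq_zero_iff] at h
    obtain ⟨z, hz⟩ := exists_ne (0 : EuclideanSpace ℂ (Fin (Quotient.out x.1).dim))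
    exact hz (φ.map_eq_zero_iff.1 (LinearMap.congr_fun h z))
  exact Set.finite_coe_iff.1 (Finite.of_injective c hc)

theorem exists_equiv_rep (p : Irrep G) :
    ∃ x : UnitaryDual G, Nonempty (Representation.Equiv x.rep p.rep.toRepresentation) :=
  ⟨⟦p⟧, Quotient.mk_out p⟩

/-- Every nonzero subrepresentation of a finite-dimensional unitary representation contains an
irreducible unitary representation. -/
theorem exists_intertwiningMap_of_subrepresentation {K : Type*} [NormedAddCommGroup K]
    [InnerProductSpace ℂ K] [FiniteDimensional ℂ K] (σ : UnitaryRep G K)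
    (T : Subrepresentation σ.toRepresentation) (hT : T ≠ ⊥) :
    ∃ (x : UnitaryDual G) (f : IntertwiningMap x.rep σ.toRepresentation),
      f ≠ 0 ∧ ∀ z, f z ∈ T := by
  have : WellFoundedLT (Subrepresentation σ.toRepresentation) :=
    StrictMono.wellFoundedLT (f := Subrepresentation.toSubmodule) fun _ _ h => h
  -- A minimal nonzero subrepresentation exists by finite dimension. An orthonormal basis transports
  -- it to `ℂᵈ`, the form required by `Irrep`.
  obtain ⟨A, hA, hAT⟩ := (eq_bot_or_exists_atom_le T).resolve_left hT
  have hmem : ∀ g, ∀ y ∈ A.toSubmodule, σ.toHom g y ∈ A.toSubmodule :=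
    fun g y hy => A.apply_mem_toSubmodule g hy
  let b := (stdOrthonormalBasis ℂ A.toSubmodule).repr
  let r : G → (A.toSubmodule ≃ₗᵢ[ℂ] A.toSubmodule) := fun g =>
    { toFun := fun y => ⟨σ.toHom g y, hmem g y y.2⟩
      invFun := fun y => ⟨σ.toHom g⁻¹ y, hmem g⁻¹ y y.2⟩
      map_add' := fun y z => Subtype.ext (map_add _ _ _)
      map_smul' := fun c z => Subtype.ext (map_smul (σ.toHom g) _ _)
      left_inv := fun y => Subtype.ext (by simp)
      right_inv := fun y => Subtype.ext (by simp)
      norm_map' := fun y => (σ.toHom g).norm_map y }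
  let π : UnitaryRep G (EuclideanSpace ℂ (Fin (Module.finrank ℂ A.toSubmodule))) :=
    { toHom :=
        { toFun := fun g => b.symm.trans ((r g).trans b)
          map_one' := by
            ext1 y
            have : r 1 (b.symm y) = b.symm y := Subtype.ext (by simp [r])
            simp [this]
          map_mul' := fun g h => by
            ext1 y
            have : r (g * h) (b.symm y) = r g (r h (b.symm y)) := Subtype.ext (by simp [r])
            simp [this] }
      continuous_apply := fun y =>
        b.continuous.comp ((σ.continuous_apply (b.symm y)).subtype_mk _) }
  let ι : IntertwiningMap π.toRepresentation σ.toRepresentation :=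
    { toLinearMap := A.toSubmodule.subtype ∘ₗ b.symm.toLinearEquiv.toLinearMap
      isIntertwining' := fun g => by
        ext1 y
        change ((b.symm (b (r g (b.symm y))) : A.toSubmodule) : K) = _
        rw [b.symm_apply_apply]
        rfl }
  have hι : Function.Injective ι := A.toSubmodule.injective_subtype.comp b.symm.injective
  have hιA : ∀ y, ι y ∈ A := fun y => (b.symm y).2
  have hsurj : ∀ a ∈ A, ∃ y, ι y = a := fun a ha => ⟨b ⟨a, ha⟩, by
    change ((b.symm (b ⟨a, ha⟩) : A.toSubmodule) : K) = a
    rw [b.symm_apply_apply]⟩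
  have hirr : π.toRepresentation.IsIrreducible := by
    have hne : (⊥ : Subrepresentation π.toRepresentation) ≠ ⊤ := by
      intro h
      refine hA.1 (eq_bot_iff.2 fun a ha => ?_)
      obtain ⟨y, rfl⟩ := hsurj a ha
      have hy : y ∈ (⊥ : Subrepresentation π.toRepresentation) := h ▸ Submodule.mem_top
      obtain rfl : y = 0 := (Submodule.mem_bot ℂ).1 hy
      exact (Submodule.mem_bot ℂ).2 (map_zero ι)
    refine { exists_pair_ne := ⟨_, _, hne⟩, eq_bot_or_eq_top := fun B => ?_ }
    -- Irreducibility is inherited from minimality: the image of `B` lies in the atom `A`, so it is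
    -- zero or all of `A`.
    let C : Subrepresentation σ.toRepresentation :=
      ⟨B.toSubmodule.map ι.toLinearMap, by
        rintro g _ ⟨y, hy, rfl⟩
        exact ⟨_, B.apply_mem_toSubmodule g hy, IntertwiningMap.isIntertwining _ _ ι g y⟩⟩
    have hCA : C ≤ A := by
      rintro _ ⟨y, -, rfl⟩
      exact hιA y
    rcases hA.le_iff.1 hCA with h | h
    · left
      refine eq_bot_iff.2 fun y hy => (Submodule.mem_bot ℂ).2 (hι ?_)
      have : ι y ∈ C := ⟨y, hy, rfl⟩
      rw [h] at this
      exact ((Submodule.mem_bot ℂ).1 this).trans (map_zero ι).symm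
    · right
      refine eq_top_iff.2 fun y _ => ?_
      have : ι y ∈ C := by rw [h]; exact hιA y
      obtain ⟨z, hz, hzy⟩ := this
      exact hι hzy ▸ hz
  obtain ⟨x, ⟨e⟩⟩ := exists_equiv_rep ⟨_, π, hirr⟩
  refine ⟨x, ι.comp e.toIntertwiningMap, fun h => ?_, fun z => hAT (hιA _)⟩
  obtain ⟨z, hz⟩ := exists_ne (0 : EuclideanSpace ℂ (Fin (Quotient.out x).dim))
  have hez : ι (e z) = ι 0 := (DFunLike.congr_fun h z).trans (map_zero ι).symm
  exact hz (e.injective ((hι hez).trans (map_zero e).symm))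

/-- The tensor product of two unitary representations. -/
noncomputable def UnitaryRep.tprod {K L : Type*} [NormedAddCommGroup K] [InnerProductSpace ℂ K]
    [NormedAddCommGroup L] [InnerProductSpace ℂ L] (σ : UnitaryRep G K) (τ : UnitaryRep G L) :
    UnitaryRep G (K ⊗[ℂ] L) where
  toHom :=
    { toFun := fun g => TensorProduct.congrIsometry (σ.toHom g) (τ.toHom g)
      map_one' := by
        ext1 t
        simp only [map_one]
        induction t with
        | zero => simp
        | tmul x y => rfl
        | add s t hs ht => rw [map_add, hs, ht, map_add]
      map_mul' := fun g h => by
        ext1 t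
        simp only [map_mul]
        induction t with
        | zero => simp
        | tmul x y => rfl
        | add s t hs ht => rw [map_add, hs, ht, map_add] }
  continuous_apply t := by
    induction t with
    | zero => simpa using continuous_const
    | tmul x y =>
      exact TensorProduct.continuous_tmul.comp
        ((σ.continuous_apply x).prodMk (τ.continuous_apply y))
    | add s t hs ht =>
      simp only [map_add]
      exact hs.add ht

theorem UnitaryRep.inner_toHom_left {K : Type*} [NormedAddCommGroup K] [InnerProductSpace ℂ K]
    (σ : UnitaryRep G K) (g : G) (x y : K) :
    inner ℂ (σ.toHom g x) y = inner ℂ x (σ.toHom g⁻¹ y) := by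
  rw [← (σ.toHom g⁻¹).inner_map_map]
  congr 1
  change (σ.toHom g⁻¹ * σ.toHom g) x = x
  rw [← map_mul, inv_mul_cancel, map_one]
  rfl

/-- The adjoint of a nonzero intertwiner between unitary representations. -/
theorem exists_adjoint_ne_zero {K L : Type*} [NormedAddCommGroup K]
    [InnerProductSpace ℂ K] [FiniteDimensional ℂ K] [NormedAddCommGroup L] [InnerProductSpace ℂ L]
    [FiniteDimensional ℂ L] (σ : UnitaryRep G K) (τ : UnitaryRep G L)
    (f : IntertwiningMap σ.toRepresentation τ.toRepresentation) (hf : f ≠ 0) :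
    ∃ f' : IntertwiningMap τ.toRepresentation σ.toRepresentation, f' ≠ 0 := by
  refine ⟨⟨f.toLinearMap.adjoint, fun g => ?_⟩, fun h => hf ?_⟩
  · ext1 y
    refine ext_inner_right ℂ fun x => ?_
    change inner ℂ (f.toLinearMap.adjoint (τ.toHom g y)) x =
      inner ℂ (σ.toHom g (f.toLinearMap.adjoint y)) x
    rw [σ.inner_toHom_left, LinearMap.adjoint_inner_left, LinearMap.adjoint_inner_left,
      τ.inner_toHom_left]
    exact congrArg _ (IntertwiningMap.isIntertwining _ _ f g⁻¹ x).symm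
  · have : f.toLinearMap.adjoint = 0 := congrArg IntertwiningMap.toLinearMap h
    refine IntertwiningMap.ext ?_
    rw [← LinearMap.adjoint_adjoint f.toLinearMap, this, map_zero]
    rfl

/-- Coordinatewise complex conjugation. -/
noncomputable def conjEquiv (d : ℕ) : EuclideanSpace ℂ (Fin d) ≃ₗᵢ⋆[ℂ] EuclideanSpace ℂ (Fin d) where
  toFun x := WithLp.toLp 2 fun i => star (x i)
  invFun x := WithLp.toLp 2 fun i => star (x i)
  map_add' x y := by ext i; simp
  map_smul' c x := by ext i; simp
  left_inv x := by ext i; simp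
  right_inv x := by ext i; simp
  norm_map' x := by simp [EuclideanSpace.norm_eq]

theorem conjEquiv_conjEquiv (d : ℕ) (x : EuclideanSpace ℂ (Fin d)) :
    conjEquiv d (conjEquiv d x) = x := (conjEquiv d).left_inv x

/-- The complex conjugate of a unitary representation on `ℂᵈ`. -/
noncomputable def UnitaryRep.conj {d : ℕ} (σ : UnitaryRep G (EuclideanSpace ℂ (Fin d))) :
    UnitaryRep G (EuclideanSpace ℂ (Fin d)) where
  toHom :=
    { toFun := fun g => ((conjEquiv d).trans (σ.toHom g)).trans (conjEquiv d)
      map_one' := by ext1 x; simp [conjEquiv_conjEquiv]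
      map_mul' := fun g h => by ext1 x; simp [conjEquiv_conjEquiv] }
  continuous_apply x := (conjEquiv d).continuous.comp (σ.continuous_apply _)

end Irreducible

/-! ### Sums of irreducibles from a given set of classes -/

section IrrepSpan

variable {G : Type u} [Group G] [TopologicalSpace G] (S : Set (UnitaryDual G))

/-- The sum of all irreducible subrepresentations of `τ` which belong to classes in `S`. -/
def irrepSpan {V : Type*} [AddCommGroup V] [Module ℂ V] (τ : Representation ℂ G V) :
    Submodule ℂ V :=
  Submodule.span ℂ {y | ∃ x ∈ S, ∃ (f : IntertwiningMap x.rep τ) (z : _), f z = y}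

variable {S}

theorem apply_mem_irrepSpan {V : Type*} [AddCommGroup V] [Module ℂ V]
    {τ : Representation ℂ G V} {x : UnitaryDual G} (hx : x ∈ S) (f : IntertwiningMap x.rep τ)
    (z : EuclideanSpace ℂ (Fin (Quotient.out x).dim)) : f z ∈ irrepSpan S τ :=
  Submodule.subset_span ⟨x, hx, f, z, rfl⟩

theorem map_mem_irrepSpan {V W : Type*} [AddCommGroup V] [Module ℂ V] [AddCommGroup W]
    [Module ℂ W] {τ : Representation ℂ G V} {π : Representation ℂ G W} (q : IntertwiningMap τ π)
    {y : V} (hy : y ∈ irrepSpan S τ) : q y ∈ irrepSpan S π := by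
  induction hy using Submodule.span_induction with
  | mem y h =>
    obtain ⟨x, hx, f, z, rfl⟩ := h
    exact apply_mem_irrepSpan hx (q.comp f) z
  | zero => rw [map_zero]; exact zero_mem _
  | add y z _ _ hy hz => rw [map_add]; exact add_mem hy hz
  | smul c y _ hy => rw [map_smul]; exact Submodule.smul_mem _ c hy

theorem irrepSpan_rep_eq_top {x : UnitaryDual G} (hx : x ∈ S) : irrepSpan S x.rep = ⊤ :=
  eq_top_iff.2 fun z _ => apply_mem_irrepSpan hx (IntertwiningMap.id _) z

/-- If `y ∉ S`, Schur's lemma makes `q` vanish on every irreducible from `S`, and these span. -/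
theorem mem_of_irrepSpan_eq_top {V : Type*} [AddCommGroup V] [Module ℂ V]
    {τ : Representation ℂ G V} (hτ : irrepSpan S τ = ⊤) {y : UnitaryDual G}
    (q : IntertwiningMap τ y.rep) (hq : q ≠ 0) : y ∈ S := by
  by_contra hy
  refine hq (IntertwiningMap.ext ?_)
  refine LinearMap.ext_on (s := _) hτ ?_
  rintro _ ⟨x, hx, f, z, rfl⟩
  by_contra hz
  refine hy (UnitaryDual.eq_of_intertwiningMap_ne_zero (q.comp f) (fun h => hz ?_) ▸ hx)
  exact DFunLike.congr_fun h z

/-- A finite-dimensional unitary representation is the sum of its irreducible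
subrepresentations. -/
theorem irrepSpan_unitaryRep_eq_top {K : Type*} [NormedAddCommGroup K] [InnerProductSpace ℂ K]
    [FiniteDimensional ℂ K] (σ : UnitaryRep G K)
    (hS : ∀ (x : UnitaryDual G) (f : IntertwiningMap x.rep σ.toRepresentation), f ≠ 0 → x ∈ S) :
    irrepSpan S σ.toRepresentation = ⊤ := by
  -- The orthogonal complement is invariant. An irreducible inside it would have its class in `S`,
  -- hence lie in the span too, and so vanish.
  let T : Subrepresentation σ.toRepresentation :=
    ⟨(irrepSpan S σ.toRepresentation)ᗮ, by
      intro g y hy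
      rw [Submodule.mem_orthogonal'] at hy ⊢
      intro t ht
      change inner ℂ (σ.toHom g y) t = 0
      rw [σ.inner_toHom_left]
      refine hy _ ?_
      induction ht using Submodule.span_induction with
      | mem y h =>
        obtain ⟨x, hx, f, z, rfl⟩ := h
        have : σ.toHom g⁻¹ (f z) = f (x.rep g⁻¹ z) :=
          (IntertwiningMap.isIntertwining _ _ f g⁻¹ z).symm
        rw [this]
        exact apply_mem_irrepSpan hx f _
      | zero => rw [map_zero]; exact zero_mem _
      | add y z _ _ hy hz => rw [map_add]; exact add_mem hy hz
      | smul c y _ hy => rw [map_smul]; exact Submodule.smul_mem _ c hy⟩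
  by_contra hne
  have hT : T ≠ ⊥ := by
    intro h
    refine hne ((Submodule.orthogonal_eq_bot_iff).1 ?_)
    exact congrArg Subrepresentation.toSubmodule h
  obtain ⟨x, f, hf, hfT⟩ := exists_intertwiningMap_of_subrepresentation σ T hT
  refine hf (DFunLike.ext _ _ fun z => ?_)
  have h₁ : f z ∈ irrepSpan S σ.toRepresentation := apply_mem_irrepSpan (hS x f hf) f z
  have h₂ : f z ∈ (irrepSpan S σ.toRepresentation)ᗮ := hfT z
  exact inner_self_eq_zero.1 (h₂ _ h₁)

/-- Evaluation of a representation on a space of homomorphisms. -/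
noncomputable def evalIntertwiningMap {U V W : Type*} [AddCommGroup U] [Module ℂ U]
    [AddCommGroup V] [Module ℂ V] [AddCommGroup W] [Module ℂ W] {τ : Representation ℂ G U}
    {σ : Representation ℂ G V} {π : Representation ℂ G W}
    (f : IntertwiningMap τ (Representation.linHom σ π)) :
    IntertwiningMap (Representation.tprod τ σ) π where
  toLinearMap := TensorProduct.lift f.toLinearMap
  isIntertwining' g := by
    ext y z
    have := LinearMap.congr_fun (IntertwiningMap.isIntertwining _ _ f g y) (σ g z)
    simp only [linHom_apply, LinearMap.comp_apply] at this
    simpa [← Module.End.mul_apply, ← map_mul] using this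

/-- The currying of an intertwiner on a tensor product. -/
noncomputable def curryIntertwiningMap {U V W : Type*} [AddCommGroup U] [Module ℂ U]
    [AddCommGroup V] [Module ℂ V] [AddCommGroup W] [Module ℂ W] {τ : Representation ℂ G U}
    {σ : Representation ℂ G V} {π : Representation ℂ G W}
    (f : IntertwiningMap (Representation.tprod τ σ) π) :
    IntertwiningMap τ (Representation.linHom σ π) where
  toLinearMap := TensorProduct.curry f.toLinearMap
  isIntertwining' g := by
    ext y z
    have := IntertwiningMap.isIntertwining _ _ f g (y ⊗ₜ σ g⁻¹ z)
    simp only [Representation.tprod_apply, TensorProduct.map_tmul] at this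
    simpa [← Module.End.mul_apply, ← map_mul] using this

end IrrepSpan

/-! ### Tensoring with the `ρ i` reaches every class -/

section TensorPowers

variable {G : Type u} [Group G] [TopologicalSpace G] {k : ℕ} {H : Fin k → Type v}
  [∀ i, NormedAddCommGroup (H i)] [∀ i, InnerProductSpace ℂ (H i)]
  [∀ i, FiniteDimensional ℂ (H i)] (ρ : ∀ i, UnitaryRep G (H i))

/-- `S` contains all constituents of `u ⊗ ρ i` for `u ∈ S`. -/
def ClosedUnderTensor (S : Set (UnitaryDual G)) : Prop :=
  ∀ (i : Fin k), ∀ w ∈ S, ∀ (x : UnitaryDual G),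
    (∃ f : IntertwiningMap x.rep (Representation.tprod w.rep (ρ i).toRepresentation), f ≠ 0) →
      x ∈ S

variable {ρ} {S : Set (UnitaryDual G)}

theorem ClosedUnderTensor.irrepSpan_tprod (hS : ClosedUnderTensor ρ S) (i : Fin k)
    {w : UnitaryDual G} (hw : w ∈ S) :
    irrepSpan S (Representation.tprod w.rep (ρ i).toRepresentation) = ⊤ :=
  irrepSpan_unitaryRep_eq_top ((Quotient.out w).rep.tprod (ρ i)) fun x f hf => hS i w hw x ⟨f, hf⟩

/-- An intertwiner `x → Hom(ρ i, π)` is the same as one `x ⊗ ρ i → π`, and the source of the latter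
is spanned by irreducibles from `S`. -/
theorem ClosedUnderTensor.apply_mem_irrepSpan (hS : ClosedUnderTensor ρ S) (i : Fin k)
    {W : Type*} [AddCommGroup W] [Module ℂ W] {π : Representation ℂ G W}
    {y : H i →ₗ[ℂ] W} (hy : y ∈ irrepSpan S (Representation.linHom (ρ i).toRepresentation π))
    (h : H i) : y h ∈ irrepSpan S π := by
  induction hy using Submodule.span_induction with
  | mem y hy =>
    obtain ⟨x, hx, f, z, rfl⟩ := hy
    refine map_mem_irrepSpan (evalIntertwiningMap f) (y := z ⊗ₜ h) ?_
    rw [hS.irrepSpan_tprod i hx]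
    trivial
  | zero => exact zero_mem _
  | add y z _ _ hy hz => exact add_mem hy hz
  | smul c y _ hy => exact Submodule.smul_mem _ c hy

/-- The target `π` is arbitrary so that induction can move the last variable into it, replacing `π`
by `Hom(ρ, π)`. This avoids regrouping tensor products. The universe of `W` is chosen to be stable
under this replacement. -/
theorem ClosedUnderTensor.multilinear_mem_irrepSpan (hS : ClosedUnderTensor ρ S) {U : Type w}
    [AddCommGroup U] [Module ℂ U] {τ : Representation ℂ G U} (hτ : irrepSpan S τ = ⊤) (N : ℕ)
    (c : Fin N → Fin k) {W : Type max v w} [AddCommGroup W] [Module ℂ W] (π : Representation ℂ G W)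
    (B : U →ₗ[ℂ] MultilinearMap ℂ (fun j => H (c j)) W)
    (hB : ∀ g y h, B (τ g y) (fun j => (ρ (c j)).toHom g (h j)) = π g (B y h))
    (y : U) (h : ∀ j, H (c j)) : B y h ∈ irrepSpan S π := by
  induction N generalizing W with
  | zero =>
    let q : IntertwiningMap τ π :=
      { toFun := fun y => B y h
        map_add' := fun y z => by simp
        map_smul' := fun a z => by simp
        isIntertwining' := fun g => by
          ext1 z
          refine Eq.trans ?_ (hB g z h)
          exact congrArg (B (τ g z)) (Subsingleton.elim _ _) }
    refine map_mem_irrepSpan q (y := y) ?_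
    rw [hτ]
    trivial
  | succ N ih =>
    have := ih (fun j => c j.castSucc)
      (Representation.linHom (ρ (c (Fin.last N))).toRepresentation π)
      ((multilinearCurryRightEquiv ℂ (fun j => H (c j)) W).toLinearMap ∘ₗ B) ?_ (Fin.init h)
    · have h' := hS.apply_mem_irrepSpan _ this (h (Fin.last N))
      have e : B y h = B y (Fin.snoc (Fin.init h) (h (Fin.last N))) := by rw [Fin.snoc_init_self]
      rw [e]
      exact h'
    · intro g y h'
      ext z
      -- On the Hom space `g` also acts by `g⁻¹` on the argument; equivariance of `B` then brings in
      -- a `g` that cancels it.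
      change B (τ g y) (Fin.snoc (fun j => (ρ (c j.castSucc)).toHom g (h' j)) z) =
        π g (B y (Fin.snoc h' ((ρ (c (Fin.last N))).toHom g⁻¹ z)))
      rw [← hB]
      congr 1
      ext j
      refine Fin.lastCases ?_ (fun j => ?_) j
      · simp only [Fin.snoc_last]
        change z = ((ρ (c (Fin.last N))).toHom g * (ρ (c (Fin.last N))).toHom g⁻¹) z
        rw [← map_mul, mul_inv_cancel, map_one]
        rfl
      · simp only [Fin.snoc_castSucc]

/-- If `τ` is the sum of its irreducible subrepresentations from `S`, so are its tensor products
with the tensor powers of the `ρ i`. -/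
theorem ClosedUnderTensor.irrepSpan_tprod_tensorPower (hS : ClosedUnderTensor ρ S) {U : Type w}
    [AddCommGroup U] [Module ℂ U] {τ : Representation ℂ G U} (hτ : irrepSpan S τ = ⊤)
    (n : Fin k → ℕ) : irrepSpan S (Representation.tprod τ (tensorPower ρ n)) = ⊤ := by
  let ι := Σ i, Fin (n i)
  let e : ι ≃ Fin (Fintype.card ι) := Fintype.equivFin ι
  -- The universal multilinear map, whose values span `U ⊗ ρⁿ`; `e` lists its index pairs as `Fin
  -- N`.
  let B₀ : U →ₗ[ℂ] MultilinearMap ℂ (fun p : ι => H p.1) (U ⊗[ℂ] (⨂[ℂ] p : ι, H p.1)) :=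
    { toFun := fun y => (TensorProduct.mk ℂ U _ y).compMultilinearMap (PiTensorProduct.tprod ℂ)
      map_add' := fun y z => by ext h; simp
      map_smul' := fun a z => by ext h; simp [TensorProduct.smul_tmul'] }
  have hB₀ : ∀ y h, B₀ y h ∈ irrepSpan S (Representation.tprod τ (tensorPower ρ n)) := by
    intro y h
    have := hS.multilinear_mem_irrepSpan hτ _ (fun j => (e.symm j).1)
      (Representation.tprod τ (tensorPower ρ n))
      ((MultilinearMap.domDomCongrLinearEquiv' ℂ ℂ (fun p : ι => H p.1)
        (U ⊗[ℂ] (⨂[ℂ] p : ι, H p.1)) e).toLinearMap ∘ₗ B₀) ?_ y (fun j => h (e.symm j))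
    · have heq : (e.piCongrLeft' fun p : ι => H p.1).symm (fun j => h (e.symm j)) = h :=
        (e.piCongrLeft' fun p : ι => H p.1).symm_apply_apply h
      change B₀ y ((e.piCongrLeft' fun p : ι => H p.1).symm (fun j => h (e.symm j))) ∈ _ at this
      rwa [heq] at this
    · intro g y h'
      obtain ⟨h, rfl⟩ := (e.piCongrLeft' fun p : ι => H p.1).surjective h'
      change B₀ (τ g y) ((e.piCongrLeft' fun p : ι => H p.1).symm
          (e.piCongrLeft' (fun p : ι => H p.1) fun p => (ρ p.1).toHom g (h p))) =
        Representation.tprod τ (tensorPower ρ n) g (B₀ y ((e.piCongrLeft' fun p : ι => H p.1).symm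
          (e.piCongrLeft' (fun p : ι => H p.1) h)))
      rw [Equiv.symm_apply_apply, Equiv.symm_apply_apply]
      change τ g y ⊗ₜ _ = τ g y ⊗ₜ (PiTensorProduct.map _ (PiTensorProduct.tprod ℂ h))
      rw [PiTensorProduct.map_tprod]
      rfl
  refine eq_top_iff.2 fun t _ => ?_
  induction t with
  | zero => exact zero_mem _
  | add s t hs ht => exact add_mem (hs trivial) (ht trivial)
  | tmul y s =>
    induction s using PiTensorProduct.induction_on with
    | smul_tprod a h =>
      rw [TensorProduct.tmul_smul]
      exact Submodule.smul_mem _ a (hB₀ y h)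
    | add s t hs ht =>
      rw [TensorProduct.tmul_add]
      exact add_mem (hs trivial) (ht trivial)

/-- Take an irreducible `x` inside the conjugate of `w`, embedded by `f`. The inner product pairs
`y` with the conjugate of `f z`; it is invariant by unitarity, and nonzero because a nonzero vector
pairs nontrivially with itself. -/
theorem exists_intertwiningMap_tprod_trivial (w : UnitaryDual G) :
    ∃ (x : UnitaryDual G)
      (φ : IntertwiningMap (Representation.tprod w.rep x.rep) (Representation.trivial ℂ G ℂ)),
      φ ≠ 0 := by
  obtain ⟨x, f, hf, -⟩ := exists_intertwiningMap_of_subrepresentation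
    (Quotient.out w).rep.conj ⊤ (by
      intro h
      obtain ⟨z, hz⟩ := exists_ne (0 : EuclideanSpace ℂ (Fin (Quotient.out w).dim))
      have : z ∈ (⊥ : Subrepresentation (Quotient.out w).rep.conj.toRepresentation) :=
        h ▸ Submodule.mem_top
      exact hz ((Submodule.mem_bot ℂ).1 this))
  let J := conjEquiv (Quotient.out w).dim
  let B : EuclideanSpace ℂ (Fin (Quotient.out w).dim) →ₗ[ℂ]
      EuclideanSpace ℂ (Fin (Quotient.out x).dim) →ₗ[ℂ] ℂ :=
    -- The conjugation `J` cancels the conjugate-linearity of the inner product in its first slot.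
    LinearMap.mk₂ ℂ (fun y z => inner ℂ (J (f z)) y)
      (fun y y' z => inner_add_right _ _ _) (fun c y z => inner_smul_right _ _ _)
      (fun y z z' => by rw [map_add, map_add, inner_add_left])
      (fun c y z => by
        rw [map_smul, map_smulₛₗ, inner_smul_left, RingHomCompTriple.comp_apply]
        rfl)
  refine ⟨x, ⟨TensorProduct.lift B, fun g => ?_⟩, fun h => hf (DFunLike.ext _ _ fun z => ?_)⟩
  · refine TensorProduct.ext' fun y z => ?_
    change inner ℂ (J (f (x.rep g z))) ((Quotient.out w).rep.toHom g y) = inner ℂ (J (f z)) y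
    have : J (f (x.rep g z)) = (Quotient.out w).rep.toHom g (J (f z)) :=
      (congrArg J (IntertwiningMap.isIntertwining _ _ f g z)).trans (conjEquiv_conjEquiv _ _)
    rw [this, LinearIsometryEquiv.inner_map_map]
  · have : inner ℂ (J (f z)) (J (f z)) = 0 := DFunLike.congr_fun h (J (f z) ⊗ₜ z)
    exact J.map_eq_zero_iff.1 (inner_self_eq_zero.1 this)

/-- If every irreducible representation is a constituent of some tensor power, then a nonempty set
of irreducible representations which contains all constituents of `u ⊗ ρ i` for its members `u`
contains all irreducible representations. -/
theorem ClosedUnderTensor.mem (hS : ClosedUnderTensor ρ S) (hR : constituents ρ = Set.univ)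
    {w : UnitaryDual G} (hw : w ∈ S) (y : UnitaryDual G) : y ∈ S := by
  obtain ⟨x, φ, hφ⟩ := exists_intertwiningMap_tprod_trivial w
  obtain ⟨m, a, b, hab⟩ : x ∈ constituents ρ := hR ▸ Set.mem_univ x
  obtain ⟨n, a', b', hab'⟩ : y ∈ constituents ρ := hR ▸ Set.mem_univ y
  have h := hS.irrepSpan_tprod_tensorPower
    (hS.irrepSpan_tprod_tensorPower (irrepSpan_rep_eq_top hw) m) n
  -- The composite `(w ⊗ ρᵐ) ⊗ ρⁿ → (w ⊗ x) ⊗ y → ℂ ⊗ y ≅ y`. At `(s ⊗ a t) ⊗ a' z` it equals `φ (s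
  -- ⊗ t) • z`, so it is nonzero.
  refine mem_of_irrepSpan_eq_top h ((Representation.TensorProduct.lid ℂ y.rep).toIntertwiningMap.comp
    ((φ.comp (b.lTensor w.rep)).tensor b')) fun h0 => hφ ?_
  obtain ⟨z, hz⟩ := exists_ne (0 : EuclideanSpace ℂ (Fin (Quotient.out y).dim))
  refine IntertwiningMap.ext (TensorProduct.ext' fun s t => ?_)
  have : φ (s ⊗ₜ b (a t)) • b' (a' z) = 0 := DFunLike.congr_fun h0 ((s ⊗ₜ a t) ⊗ₜ a' z)
  rw [hab, hab', smul_eq_zero] at this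
  exact this.resolve_right hz

end TensorPowers

/-! ### Finiteness and nonvanishing of the multiplicities -/

section Multiplicities

variable {G : Type u} [Group G] [TopologicalSpace G] {K : Type*} [NormedAddCommGroup K]
  [InnerProductSpace ℂ K] [FiniteDimensional ℂ K] (σ : UnitaryRep G K)

theorem tensorMult_ne_zero_iff (w x : UnitaryDual G) :
    tensorMult σ w x ≠ 0 ↔
      ∃ f : IntertwiningMap x.rep (Representation.tprod w.rep σ.toRepresentation), f ≠ 0 := by
  rw [tensorMult, ← Nat.pos_iff_ne_zero, Module.finrank_pos_iff_exists_ne_zero]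

theorem finite_tensorMult_ne_zero_right (w : UnitaryDual G) :
    {x | tensorMult σ w x ≠ 0}.Finite := by
  simp only [tensorMult_ne_zero_iff]
  exact finite_constituents _

/-- The adjoint of a nonzero `x → w ⊗ σ` curries to a nonzero `w → Hom(σ, x)`, so `w` occurs in a
finite-dimensional representation independent of `w`. -/
theorem finite_tensorMult_ne_zero_left (x : UnitaryDual G) :
    {w | tensorMult σ w x ≠ 0}.Finite := by
  refine (finite_constituents (Representation.linHom σ.toRepresentation x.rep)).subset ?_
  intro w hw
  obtain ⟨f, hf⟩ := (tensorMult_ne_zero_iff σ w x).1 hw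
  obtain ⟨f', hf'⟩ := exists_adjoint_ne_zero (Quotient.out x).rep ((Quotient.out w).rep.tprod σ) f hf
  refine ⟨curryIntertwiningMap (τ := w.rep) f', fun h => hf' (IntertwiningMap.ext ?_)⟩
  refine TensorProduct.ext' fun y z => ?_
  exact LinearMap.congr_fun (DFunLike.congr_fun h y) z

theorem exists_tensorMult_ne_zero [Nontrivial K] (w : UnitaryDual G) :
    ∃ x, tensorMult σ w x ≠ 0 := by
  obtain ⟨x, f, hf, -⟩ := exists_intertwiningMap_of_subrepresentation
    ((Quotient.out w).rep.tprod σ) ⊤ (by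
      intro h
      have h0 : ∀ t ∈ (⊤ : Subrepresentation ((Quotient.out w).rep.tprod σ).toRepresentation),
          t = 0 := by
        rw [h]
        exact fun t ht => (Submodule.mem_bot ℂ).1 ht
      obtain ⟨y, hy⟩ := exists_ne (0 : EuclideanSpace ℂ (Fin (Quotient.out w).dim))
      obtain ⟨z, hz⟩ := exists_ne (0 : K)
      have := congrArg Norm.norm (h0 (y ⊗ₜ z) Submodule.mem_top)
      rw [TensorProduct.norm_tmul, norm_zero, mul_eq_zero, norm_eq_zero, norm_eq_zero] at this
      tauto)
  exact ⟨x, (tensorMult_ne_zero_iff σ w x).2 ⟨f, hf⟩⟩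

end Multiplicities

/-- There are countably many `n`, and each `ρⁿ` has finitely many constituents. -/
theorem countable_constituents {G : Type u} [Group G] [TopologicalSpace G] {k : ℕ}
    {H : Fin k → Type v} [∀ i, NormedAddCommGroup (H i)] [∀ i, InnerProductSpace ℂ (H i)]
    [∀ i, FiniteDimensional ℂ (H i)] (ρ : ∀ i, UnitaryRep G (H i)) :
    (constituents ρ).Countable := by
  refine (Set.countable_iUnion fun n : Fin k → ℕ =>
    (finite_constituents (tensorPower ρ n)).countable).mono ?_
  rintro x ⟨n, a, b, hab⟩
  refine Set.mem_iUnion.2 ⟨n, a, fun h => ?_⟩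
  obtain ⟨z, hz⟩ := exists_ne (0 : EuclideanSpace ℂ (Fin (Quotient.out x).dim))
  refine hz ?_
  rw [← hab z, h]
  exact map_zero b

end RepKGraph

/-! ### The main theorem -/

theorem mainTheorem6 {G : Type u} [Group G] [TopologicalSpace G] [IsTopologicalGroup G]
    [CompactSpace G] [T2Space G] {k : ℕ} {H : Fin k → Type v}
    [∀ i, NormedAddCommGroup (H i)] [∀ i, InnerProductSpace ℂ (H i)]
    [∀ i, FiniteDimensional ℂ (H i)] [∀ i, Nontrivial (H i)]
    (ρ : ∀ i, RepKGraph.UnitaryRep G (H i))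
    (hfaithful : ∀ i, Function.Injective (ρ i).toHom)
    (hR : RepKGraph.constituents ρ = Set.univ)
    (E : RepKGraph.ColouredGraph k (RepKGraph.constituents ρ))
    (hE : ∀ (i : Fin k) (w v : RepKGraph.constituents ρ),
      ENat.card (E.Edge i w v) = (RepKGraph.tensorMult (ρ i) w.1 v.1 : ℕ∞))
    (sq : E.Squares) (hsq : E.IsAssociative sq) :
    (∃ Λ : RepKGraph.KGraph.{u} k, Nonempty (E.Realization sq Λ)) ∧
    (∀ (Λ Λ' : RepKGraph.KGraph.{u} k) (P : E.Realization sq Λ) (P' : E.Realization sq Λ'),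
      ∃ Φ : RepKGraph.KGraph.Iso Λ Λ', P.Compatible P' Φ) ∧
    (∀ Λ : RepKGraph.KGraph.{u} k, Nonempty (E.Realization sq Λ) →
      Λ.Cofinal ∧ Λ.LocallyFinite ∧ Λ.NoSources) := by
  have hV : Countable (RepKGraph.constituents ρ) := RepKGraph.countable_constituents ρ
  have hfin : ∀ i w v, Finite (E.Edge i w v) := fun i w v => by
    rw [← ENat.card_lt_top, hE]
    exact ENat.natCast_lt_top _
  have hedge : ∀ i w v, Nonempty (E.Edge i w v) ↔ RepKGraph.tensorMult (ρ i) w.1 v.1 ≠ 0 :=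
    fun i w v => by
      rw [← Nat.cast_ne_zero (R := ℕ∞), ← hE, ENat.card_ne_zero_iff_nonempty]
  refine ⟨⟨E.toKGraph sq hsq, ⟨RepKGraph.ColouredGraph.toKGraphRealization sq hsq⟩⟩,
    fun Λ Λ' P P' => ⟨_, (P.compatible_isoOfToKGraph hsq).symm_trans
      (P'.compatible_isoOfToKGraph hsq)⟩, ?_⟩
  rintro Λ ⟨P⟩
  refine ⟨P.cofinal fun w v => ?_, P.locallyFinite (fun i w => ?_) (fun i v => ?_),
    P.noSources fun i w => ?_⟩
  -- The sources of edge paths with range `w`. A constituent of `y ⊗ ρ i` is the source of an edge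
  -- with range `y`, which extends a path at its source end.
  · let S : Set (RepKGraph.UnitaryDual G) := {x | ∃ hx, Nonempty (E.EdgePath w ⟨x, hx⟩)}
    have hS : RepKGraph.ClosedUnderTensor ρ S := by
      rintro i y ⟨hy, ⟨p⟩⟩ x hx
      have hx' : x ∈ RepKGraph.constituents ρ := hR ▸ Set.mem_univ x
      obtain ⟨e⟩ := (hedge i ⟨y, hy⟩ ⟨x, hx'⟩).2 ((RepKGraph.tensorMult_ne_zero_iff _ _ _).2 hx)
      exact ⟨hx', ⟨p.append (.cons i e (.nil _))⟩⟩
    obtain ⟨_, hp⟩ := hS.mem hR (w := w.1) ⟨w.2, ⟨.nil w⟩⟩ v.1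
    exact hp
  · have : Finite {v : RepKGraph.constituents ρ // Nonempty (E.Edge i w v)} := by
      simp only [hedge]
      exact ((RepKGraph.finite_tensorMult_ne_zero_right (ρ i) w.1).preimage
        Subtype.val_injective.injOn).to_subtype
    -- The vertex set may be infinite, so the sum is restricted to the finitely many vertices that
    -- carry an edge.
    exact Finite.of_injective
      (fun e : Σ v, E.Edge i w v =>
        (⟨⟨e.1, ⟨e.2⟩⟩, e.2⟩ : Σ v : {v // Nonempty (E.Edge i w v)}, E.Edge i w v.1))
      (by rintro ⟨x, e⟩ ⟨y, f⟩ h; cases h; rfl)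
  · have : Finite {w : RepKGraph.constituents ρ // Nonempty (E.Edge i w v)} := by
      simp only [hedge]
      exact ((RepKGraph.finite_tensorMult_ne_zero_left (ρ i) v.1).preimage
        Subtype.val_injective.injOn).to_subtype
    exact Finite.of_injective
      (fun e : Σ w, E.Edge i w v =>
        (⟨⟨e.1, ⟨e.2⟩⟩, e.2⟩ : Σ w : {w // Nonempty (E.Edge i w v)}, E.Edge i w.1 v))
      (by rintro ⟨x, e⟩ ⟨y, f⟩ h; cases h; rfl)
  · obtain ⟨x, hx⟩ := RepKGraph.exists_tensorMult_ne_zero (ρ i) w.1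
    exact ⟨⟨x, hR ▸ Set.mem_univ x⟩, (hedge i w ⟨x, _⟩).2 hx⟩
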